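/- Setting. Let $\mathbb S=\mathbb R/\mathbb Z$, let $f:\mathbb R^n\times\mathbb R^q\to\mathbb R^n$ be $C^1$, let $\rho$ be irrational, $T\in\mathbb R$, $p\in\mathbb R^q$, and let $v$ be a $C^1$ solution of the torus problem $$\partial_\tau v=Tf(v,p),\qquad v(\phi,1)=v(\phi+\rho,0)\qquad(\phi\in\mathbb S,\ \tau\in[0,1]),$$ extended to $\mathbb S\times\mathbb R$ by $v(\phi,\tau+1)=v(\phi+\rho,\tau)$. Let $V$ solve $\partial_\tau V=T\,\partial_xf(v,p)V$, $V(\cdot,0)=I$, and put $P(\phi,\tau)=T\,V(\phi,\tau)\int_0^\tau V(\phi,\sigma)^{-1}\partial_pf(v(\phi,\sigma),p)\,d\sigma$ and $$\Gamma_{\rho,\tau}[w](\phi)=V(\phi-\rho,\tau+1)V(\phi-\rho,\tau)^{-1}w(\phi-\rho)-w(\phi).$$ Assume that $v$ is normally hyperbolic: $\partial_\tau v,\partial_\phi v$ are pointwise linearly independent, and there are continuous row-vector fields $q_\tau^{\mathsf T},q_\phi^{\mathsf T}$ on $\mathbb S\times\mathbb R$ such that $q_{\rm tg}=\partial_\tau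 v\,q_\tau^{\mathsf T}+\partial_\phi v\,q_\phi^{\mathsf T}$ is pointwise a projection onto $\operatorname{span}\{\partial_\tau v,\partial_\phi v\}$, $q_{\rm tg}(\phi,\tau+1)=q_{\rm tg}(\phi+\rho,\tau)$, $q_{\rm tg}(\phi,\tau)V(\phi,\tau)=V(\phi,\tau)q_{\rm tg}(\phi,0)$, and each $\Gamma_{\rho,\tau}$ is a bijection with bounded inverse (sup-norm) on the space of functions $\phi\mapsto(I-q_{\rm tg}(\phi,\tau))\delta(\phi)$, $\delta\in C(\mathbb S,\mathbb R^n)$. Let $h=(h_1,h_2)$ be phase conditions with $h(v,p)=0$ that are differentiable at $(v,p)$ along $C^1$ directions with derivative $\int_{\mathbb S}\int_0^1\partial_vh\,\delta_v\,d\tau\,d\phi+\partial_ph\,\delta_p$, where $\partial_vh$ is a continuous density on $\mathbb S\times[0,1]$, and such that the $2\times2$ matrix $\int_{\mathbb S}\int_0^1\partial_vh\,[\partial_\tau v\ \ \partial_\phi v]\,d\tau\,d\phi$ is nonsingular. Let $X$ be the space of $(\delta_v,\delta_T,\delta_\rho,\delta_p)$ with $\delta_v,\partial_\tau\delta_v$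 continuous on $\mathbb S\times[0,1]$, normed by the maximum of $\|\delta_v\|_\infty,\|\partial_\tau\delta_v\|_\infty,|\delta_T|,|\delta_\rho|,|\delta_p|$. Let $L_0$ be the linearized zero problem $(\delta_v,\delta_T,\delta_\rho,\delta_p)\mapsto(\delta_{\rm ode},\delta_{\rm bc},\delta_h)\in C(\mathbb S\times[0,1],\mathbb R^n)\times C(\mathbb S,\mathbb R^n)\times\mathbb R^2$ (sup-norms), $$\delta_{\rm ode}=\partial_\tau\delta_v-T\partial_xf(v,p)\delta_v-f(v,p)\delta_T-T\partial_pf(v,p)\delta_p,$$ $$\delta_{\rm bc}=\delta_v(\cdot+\rho,0)-\delta_v(\cdot,1)+\partial_\phi v(\cdot+\rho,0)\delta_\rho,\qquad \delta_h=\int_{\mathbb S}\int_0^1\partial_vh\,\delta_v\,d\tau\,d\phi+\partial_ph\,\delta_p,$$ let $L=(L_0,\delta_p)$ be the linearization of the reduced problem in which $p$ is prescribed, and put $\delta_{\rm rhs}(\phi)=\delta_{\rm bc}(\phi)+V(\phi,1)\int_0^1V(\phi,\sigma)^{-1}\delta_{\rm ode}(\phi,\sigma)\,d\sigma$. Theorem.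 (1) The small divisors $1-e^{-2\pi ik\rho}$, $k\in\mathbb Z\setminus\{0\}$, are nonzero and arbitrarily small. For every element of $X$, every $k\neq0$, and $r=q_\tau$ or $r=q_\phi$, the $k$-th Fourier coefficient of $r^{\mathsf T}(\phi,0)\delta_v(\phi,0)$ multiplied by $1-e^{-2\pi ik\rho}$ equals the $k$-th Fourier coefficient of $r^{\mathsf T}(\phi,0)\bigl(\delta_{\rm rhs}(\phi-\rho)+P(\phi-\rho,1)\delta_p\bigr)$. (2) $L$ is injective with dense range, but has no bounded inverse; indeed for every $C$ there is an element of $X$ with $\delta_v$ of class $C^1$, $\|L(\delta_v,\delta_T,\delta_\rho,\delta_p)\|\le1$ and $\|\delta_v\|_\infty>C$. Moreover, for no $d$ and no bounded linear $\psi:X\to\mathbb R^d$ does $(L_0,\psi)$ have a bounded inverse. (3) For every element of $X$, $$\int_{\mathbb S}q_\tau^{\mathsf T}(\phi-\rho,1)\delta_{\rm rhs}(\phi-\rho)\,d\phi+\int_{\mathbb S}q_\tau^{\mathsf T}(\phi-\rho,1)P(\phi-\rho,1)\,d\phi\;\delta_p=-\frac{\delta_T}{T},$$ $$\int_{\mathbb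 S}q_\phi^{\mathsf T}(\phi-\rho,1)\delta_{\rm rhs}(\phi-\rho)\,d\phi+\int_{\mathbb S}q_\phi^{\mathsf T}(\phi-\rho,1)P(\phi-\rho,1)\,d\phi\;\delta_p=\delta_\rho .$$ (4) Consider the adjoint conditions for $(\lambda_{\rm de},\lambda_{\rm bc},\lambda_{\rm ps},\eta_p)$ with $\lambda_{\rm bc}$ continuous and given $(\eta_T,\eta_\rho)$: $$0=-\partial_\tau\lambda_{\rm de}^{\mathsf T}-T\lambda_{\rm de}^{\mathsf T}\partial_xf(v,p)+\lambda_{\rm ps}^{\mathsf T}\partial_vh,\quad \lambda_{\rm de}(\phi,1)=\lambda_{\rm bc}(\phi),\quad \lambda_{\rm de}(\phi,0)=\lambda_{\rm bc}(\phi-\rho),$$ $$0=-\int_{\mathbb S}\int_0^1\lambda_{\rm de}^{\mathsf T}f(v,p)\,d\tau\,d\phi+\eta_T,\qquad 0=\int_{\mathbb S}\lambda_{\rm bc}^{\mathsf T}(\phi)\,\partial_\phi v(\phi+\rho,0)\,d\phi+\eta_\rho,$$ $$0=-\int_{\mathbb S}\int_0^1T\lambda_{\rm de}^{\mathsf T}\partial_pf(v,p)\,d\tau\,d\phi+\eta_p^{\mathsf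 T}+\lambda_{\rm ps}^{\mathsf T}\partial_ph .$$ For $(\eta_T,\eta_\rho)=(1,0)$ the unique solution on $\mathbb S\times[0,1]$ is $\lambda_{\rm de}=Tq_\tau$, $\lambda_{\rm bc}=Tq_\tau(\cdot,1)$, $\lambda_{\rm ps}=0$, $\eta_p^{\mathsf T}=T\int_{\mathbb S}q_\tau^{\mathsf T}(\phi,1)P(\phi,1)\,d\phi$. For $(\eta_T,\eta_\rho)=(0,1)$ it is $\lambda_{\rm de}=-q_\phi$, $\lambda_{\rm bc}=-q_\phi(\cdot,1)$, $\lambda_{\rm ps}=0$, $\eta_p^{\mathsf T}=-\int_{\mathbb S}q_\phi^{\mathsf T}(\phi,1)P(\phi,1)\,d\phi$. (5) The rows of the inverse of $L$ giving $\delta_T$ and $\delta_\rho$ are bounded: there are bounded linear functionals $R_T,R_\rho$ on the data space with $R_T(Lx)=\delta_T$ and $R_\rho(Lx)=\delta_\rho$ for all $x=(\delta_v,\delta_T,\delta_\rho,\delta_p)\in X$. They are the adjoint sensitivities: for all data, $$R_{T}\ (\text{resp. }R_\rho)\;=\;-\int_{\mathbb S}\int_0^1\lambda_{\rm de}^{\mathsf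 T}\delta_{\rm ode}\,d\tau\,d\phi-\int_{\mathbb S}\lambda_{\rm bc}^{\mathsf T}\delta_{\rm bc}\,d\phi-\lambda_{\rm ps}^{\mathsf T}\delta_h-\eta_p^{\mathsf T}\delta_p$$ with the adjoint solution for $(\eta_T,\eta_\rho)=(1,0)$ (resp. $(0,1)$). In particular, data with only $\delta_p\ne0$ give $R_T=-\eta_p^{\mathsf T}\delta_p$ with $\eta_p^{\mathsf T}=T\int_{\mathbb S}q_\tau^{\mathsf T}(\phi,1)P(\phi,1)\,d\phi$ and $R_\rho=-\eta_p^{\mathsf T}\delta_p$ with $\eta_p^{\mathsf T}=-\int_{\mathbb S}q_\phi^{\mathsf T}(\phi,1)P(\phi,1)\,d\phi$, and data with only $\delta_h\ne0$ give $R_T=R_\rho=0$. -/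

import Mathlib

open MeasureTheory Set

namespace QPTorus

/-- The circle `ℝ / ℤ`, of total length one. -/
abbrev Circ := UnitAddCircle

/-- The Euclidean space `ℝⁿ` (column vectors). -/
abbrev Vec (n : ℕ) := EuclideanSpace ℝ (Fin n)

/-- Row vectors, i.e. linear functionals on `ℝⁿ`. -/
abbrev Cov (n : ℕ) := Vec n →L[ℝ] ℝ

/-- The cylinder `𝕊 × [0,1]`. -/
abbrev Strip := Circ × unitInterval

variable {n q : ℕ}

/-- `∂_φ v (φ, τ)`. -/
noncomputable def dphi (v : Circ → ℝ → Vec n) (φ : Circ) (τ : ℝ) : Vec n :=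
  deriv (fun s : ℝ => v (φ + (s : Circ)) τ) 0

/-- `∂_τ v (φ, τ)`. -/
noncomputable def dtau (v : Circ → ℝ → Vec n) (φ : Circ) (τ : ℝ) : Vec n :=
  deriv (v φ) τ

/-- Continuous differentiability of a function of `(φ, τ) ∈ 𝕊 × ℝ`. -/
def IsC1 (v : Circ → ℝ → Vec n) : Prop :=
  ContDiff ℝ 1 (fun z : ℝ × ℝ => v (z.1 : Circ) z.2)

/-- Continuous differentiability of a vector field depending on parameters. -/
def IsC1Field (f : Vec n → Vec q → Vec n) : Prop :=
  ContDiff ℝ 1 (fun z : Vec n × Vec q => f z.1 z.2)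

/-- `∂_x f (x, p)`. -/
noncomputable def dx (f : Vec n → Vec q → Vec n) (x : Vec n) (p : Vec q) : Vec n →L[ℝ] Vec n :=
  fderiv ℝ (fun y => f y p) x

/-- `∂_p f (x, p)`. -/
noncomputable def dp (f : Vec n → Vec q → Vec n) (x : Vec n) (p : Vec q) : Vec q →L[ℝ] Vec n :=
  fderiv ℝ (f x) p

/-- `v` is a continuously differentiable solution of the torus boundary-value problem
`∂_τ v = T f(v, p)`, `v(φ, 1) = v(φ + ρ, 0)` on `𝕊 × [0,1]`. Such a solution extends uniquely to
`𝕊 × ℝ` as a solution with `v(φ, τ + 1) = v(φ + ρ, τ)`, and `v` stands for this extension. -/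
structure IsTorusSolution (f : Vec n → Vec q → Vec n) (T ρ : ℝ) (p : Vec q)
    (v : Circ → ℝ → Vec n) : Prop where
  c1 : IsC1 v
  ode : ∀ φ τ, HasDerivAt (v φ) (T • f (v φ τ) p) τ
  bc : ∀ φ τ, v φ (τ + 1) = v (φ + (ρ : Circ)) τ

/-- `V` is the solution of the variational initial-value problem
`∂_τ V = T ∂_x f(v, p) V`, `V(·, 0) = I`. -/
structure IsVariationalSolution (f : Vec n → Vec q → Vec n) (T : ℝ) (p : Vec q)
    (v : Circ → ℝ → Vec n) (V : Circ → ℝ → Vec n →L[ℝ] Vec n) : Prop where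
  init : ∀ φ, V φ 0 = ContinuousLinearMap.id ℝ (Vec n)
  ode : ∀ φ τ, HasDerivAt (V φ) (T • (dx f (v φ τ) p).comp (V φ τ)) τ

/-- `Γ_{ρ,τ}[w](φ) = V(φ - ρ, τ + 1) V(φ - ρ, τ)⁻¹ w(φ - ρ) - w(φ)`. -/
noncomputable def Gam (ρ : ℝ) (V : Circ → ℝ → Vec n →L[ℝ] Vec n) (τ : ℝ) (w : Circ → Vec n)
    (φ : Circ) : Vec n :=
  V (φ - (ρ : Circ)) (τ + 1) ((V (φ - (ρ : Circ)) τ).inverse (w (φ - (ρ : Circ)))) - w φ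

/-- `q_tg = ∂_τ v q_τᵀ + ∂_φ v q_φᵀ`. -/
noncomputable def qtg (v : Circ → ℝ → Vec n) (qτ qφ : Circ → ℝ → Cov n) (φ : Circ) (τ : ℝ) :
    Vec n →L[ℝ] Vec n :=
  (qτ φ τ).smulRight (dtau v φ τ) + (qφ φ τ).smulRight (dphi v φ τ)

/-- `q_tr = I - q_tg`. -/
noncomputable def qtr (v : Circ → ℝ → Vec n) (qτ qφ : Circ → ℝ → Cov n) (φ : Circ) (τ : ℝ) :
    Vec n →L[ℝ] Vec n :=
  ContinuousLinearMap.id ℝ (Vec n) - qtg v qτ qφ φ τ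

/-- The functions `φ ↦ q_tr(φ, τ) δ(φ)` with `δ` continuous on the circle. -/
def IsTransversal (v : Circ → ℝ → Vec n) (qτ qφ : Circ → ℝ → Cov n) (τ : ℝ)
    (w : C(Circ, Vec n)) : Prop :=
  ∃ δ : C(Circ, Vec n), ∀ φ, w φ = qtr v qτ qφ φ τ (δ φ)

/-- Normal hyperbolicity of `v`, with tangential projections `q_tg = ∂_τ v q_τᵀ + ∂_φ v q_φᵀ`:
a continuous invariant family of projections onto the (two-dimensional) tangent spaces, such that
every `Γ_{ρ,τ}` is a bijection with bounded inverse on the space of transversal perturbations. -/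
structure IsNormallyHyperbolic (ρ : ℝ) (v : Circ → ℝ → Vec n)
    (V : Circ → ℝ → Vec n →L[ℝ] Vec n) (qτ qφ : Circ → ℝ → Cov n) : Prop where
  cont_qτ : Continuous fun z : Circ × ℝ => qτ z.1 z.2
  cont_qφ : Continuous fun z : Circ × ℝ => qφ z.1 z.2
  indep : ∀ φ τ, LinearIndependent ℝ ![dtau v φ τ, dphi v φ τ]
  proj : ∀ φ τ, (qtg v qτ qφ φ τ).comp (qtg v qτ qφ φ τ) = qtg v qτ qφ φ τ
  range_eq : ∀ φ τ, Set.range (qtg v qτ qφ φ τ) =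
    (Submodule.span ℝ {dtau v φ τ, dphi v φ τ} : Submodule ℝ (Vec n))
  shift : ∀ φ τ, qtg v qτ qφ φ (τ + 1) = qtg v qτ qφ (φ + (ρ : Circ)) τ
  invariant : ∀ φ τ, (qtg v qτ qφ φ τ).comp (V φ τ) = (V φ τ).comp (qtg v qτ qφ φ 0)
  bijective : ∀ τ : ℝ, ∃ C : ℝ, ∀ g : C(Circ, Vec n), IsTransversal v qτ qφ τ g →
    ∃ w : C(Circ, Vec n), IsTransversal v qτ qφ τ w ∧ (∀ φ, Gam ρ V τ w φ = g φ) ∧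
      ‖w‖ ≤ C * ‖g‖ ∧
      ∀ w' : C(Circ, Vec n), IsTransversal v qτ qφ τ w' → (∀ φ, Gam ρ V τ w' φ = g φ) → w' = w

/-- The two phase conditions `h(v, p) = 0`: the functional `h` is differentiable at `(v, p)` along
continuously differentiable directions, with derivative
`∫_𝕊 ∫_0^1 ∂_v h (φ,τ) δ_v(φ,τ) dτ dφ + ∂_p h δ_p`, where `∂_v h = K` is a continuous row-vector
valued density and `∂_p h = H`, and the non-degeneracy matrix is nonsingular. -/
structure IsPhaseCondition (h : (Strip → Vec n) → Vec q → Fin 2 → ℝ) (p : Vec q)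
    (v : Circ → ℝ → Vec n) (K : Fin 2 → C(Strip, Cov n)) (H : Fin 2 → Cov q) : Prop where
  zero : h (fun z => v z.1 z.2) p = 0
  deriv_eq : ∀ w : Circ → ℝ → Vec n, IsC1 w → ∀ δp : Vec q, ∀ i : Fin 2,
    HasDerivAt (fun s : ℝ => h (fun z => v z.1 z.2 + s • w z.1 z.2) (p + s • δp) i)
      ((∫ φ : Circ, ∫ τ : unitInterval, K i (φ, τ) (w φ τ)) + H i δp) 0
  nondegenerate : (Matrix.of fun i : Fin 2 =>
    ![∫ φ : Circ, ∫ τ : unitInterval, K i (φ, τ) (dtau v φ τ),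
      ∫ φ : Circ, ∫ τ : unitInterval, K i (φ, τ) (dphi v φ τ)]).det ≠ 0

/-- `P(φ, τ) = T V(φ, τ) ∫_0^τ V(φ, σ)⁻¹ ∂_p f(v(φ, σ), p) dσ`. -/
noncomputable def PMat (f : Vec n → Vec q → Vec n) (T : ℝ) (p : Vec q) (v : Circ → ℝ → Vec n)
    (V : Circ → ℝ → Vec n →L[ℝ] Vec n) (φ : Circ) (τ : ℝ) : Vec q →L[ℝ] Vec n :=
  T • (V φ τ).comp (∫ σ in (0 : ℝ)..τ, (V φ σ).inverse.comp (dp f (v φ σ) p))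

/-- `δ_rhs(φ) = δ_bc(φ) + V(φ, 1) ∫_0^1 V(φ, σ)⁻¹ δ_ode(φ, σ) dσ`. -/
noncomputable def deltaRhs (V : Circ → ℝ → Vec n →L[ℝ] Vec n) (δode : C(Strip, Vec n))
    (δbc : C(Circ, Vec n)) (φ : Circ) : Vec n :=
  δbc φ + V φ 1 (∫ σ : unitInterval, (V φ σ).inverse (δode (φ, σ)))

/-- The Banach space of continuous `w : 𝕊 × [0,1] → ℝⁿ` with continuous `∂_τ w`, realised as the
pairs `(w, ∂_τ w)`, with the norm `max (‖w‖_∞) (‖∂_τ w‖_∞)`. -/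
def StripFun (n : ℕ) : Submodule ℝ (C(Strip, Vec n) × C(Strip, Vec n)) where
  carrier := {w | ∀ (φ : Circ) (τ : unitInterval),
    HasDerivWithinAt (fun s : ℝ => w.1 (φ, projIcc 0 1 zero_le_one s)) (w.2 (φ, τ))
      (Icc 0 1) (τ : ℝ)}
  add_mem' := fun ha hb φ τ => (ha φ τ).add (hb φ τ)
  zero_mem' := fun _ τ => hasDerivWithinAt_const (τ : ℝ) (Icc 0 1) (0 : Vec n)
  smul_mem' := fun c _ ha φ τ => (ha φ τ).const_smul c

/-- Variations `(δ_v, δ_T, δ_ρ, δ_p)` of the unknowns. -/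
abbrev Unknowns (n q : ℕ) := StripFun n × ℝ × ℝ × Vec q

/-- Constraint violations `(δ_ode, δ_bc, δ_h)`. -/
abbrev Violations (n : ℕ) := C(Strip, Vec n) × C(Circ, Vec n) × EuclideanSpace ℝ (Fin 2)

theorem IsC1.continuous {v : Circ → ℝ → Vec n} (hv : IsC1 v) :
    Continuous fun z : Circ × ℝ => v z.1 z.2 := by
  have hq : IsOpenQuotientMap (Prod.map (fun x : ℝ => (x : Circ)) (id : ℝ → ℝ)) :=
    (QuotientAddGroup.isOpenQuotientMap_mk).prodMap IsOpenQuotientMap.id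
  exact hq.isQuotientMap.continuous_iff.2 (ContDiff.continuous hv)

theorem IsC1.continuous_dphi {v : Circ → ℝ → Vec n} (hv : IsC1 v) (τ : ℝ) :
    Continuous fun φ : Circ => dphi v φ τ := by
  have hq : IsOpenQuotientMap (fun x : ℝ => (x : Circ)) := QuotientAddGroup.isOpenQuotientMap_mk
  refine hq.isQuotientMap.continuous_iff.2 ?_
  have hv' : ContDiff ℝ 1 (fun z : ℝ × ℝ => v (z.1 : Circ) z.2) := hv
  have h : ∀ x : ℝ, dphi v (x : Circ) τ =
      fderiv ℝ (fun z : ℝ × ℝ => v (z.1 : Circ) z.2) (x, τ) (1, 0) := by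
    intro x
    have h1 : HasDerivAt (fun s : ℝ => (x + s, τ)) ((1 : ℝ), (0 : ℝ)) 0 :=
      ((hasDerivAt_id (0 : ℝ)).const_add x).prodMk (hasDerivAt_const _ _)
    have h2 : HasFDerivAt (fun z : ℝ × ℝ => v (z.1 : Circ) z.2)
        (fderiv ℝ (fun z : ℝ × ℝ => v (z.1 : Circ) z.2) (x, τ)) (x + 0, τ) := by
      rw [add_zero]
      exact (hv'.differentiable (by norm_num) _).hasFDerivAt
    have h3 := h2.comp_hasDerivAt (0 : ℝ) h1
    simpa [dphi, Function.comp_def] using h3.deriv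
  have h' : ((fun φ : Circ => dphi v φ τ) ∘ fun x : ℝ => (x : Circ)) = fun x : ℝ =>
      fderiv ℝ (fun z : ℝ × ℝ => v (z.1 : Circ) z.2) (x, τ) (1, 0) := funext h
  have hpair : Continuous fun x : ℝ => (x, τ) := by fun_prop
  rw [h']
  exact ((hv'.continuous_fderiv (by norm_num)).comp hpair).clm_apply continuous_const

theorem IsC1Field.continuous_dx {f : Vec n → Vec q → Vec n} (hf : IsC1Field f) (p : Vec q) :
    Continuous fun x : Vec n => dx f x p := by
  have h : ContDiff ℝ 1 fun x : Vec n => f x p :=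
    ContDiff.comp (g := fun z : Vec n × Vec q => f z.1 z.2) hf
      (contDiff_id.prodMk contDiff_const)
  exact h.continuous_fderiv (by norm_num)

theorem IsC1Field.continuous_dp {f : Vec n → Vec q → Vec n} (hf : IsC1Field f) (p : Vec q) :
    Continuous fun x : Vec n => dp f x p := by
  have hf' : ContDiff ℝ 1 (fun z : Vec n × Vec q => f z.1 z.2) := hf
  have hpair : Continuous fun x : Vec n => (x, p) := by fun_prop
  have h : (fun x : Vec n => dp f x p) = fun x =>
      (fderiv ℝ (fun z : Vec n × Vec q => f z.1 z.2) (x, p)).comp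
        (ContinuousLinearMap.inr ℝ (Vec n) (Vec q)) := by
    funext x
    have h2 : HasFDerivAt (fun z : Vec n × Vec q => f z.1 z.2) _ (x, p) :=
      (hf'.differentiable (by norm_num) (x, p)).hasFDerivAt
    exact (h2.comp p (hasFDerivAt_prodMk_right x p)).fderiv
  rw [h]
  exact ((hf'.continuous_fderiv (by norm_num)).comp hpair).clm_comp continuous_const

theorem IsC1Field.continuous {f : Vec n → Vec q → Vec n} (hf : IsC1Field f) (p : Vec q) :
    Continuous fun x : Vec n => f x p :=
  (ContDiff.continuous (f := fun z : Vec n × Vec q => f z.1 z.2) hf).comp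
    (continuous_id.prodMk continuous_const)

/-- The first linearized equation:
`δ_ode = ∂_τ δ_v - T ∂_x f(v,p) δ_v - f(v,p) δ_T - T ∂_p f(v,p) δ_p`. -/
noncomputable def linOde {f : Vec n → Vec q → Vec n} (hf : IsC1Field f) (T : ℝ) (p : Vec q)
    {v : Circ → ℝ → Vec n} (hv : IsC1 v) (x : Unknowns n q) : C(Strip, Vec n) where
  toFun z := x.1.1.2 z - T • dx f (v z.1 z.2) p (x.1.1.1 z) - x.2.1 • f (v z.1 z.2) p
    - T • dp f (v z.1 z.2) p x.2.2.2
  continuous_toFun := by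
    have h0 : Continuous fun z : Strip => v z.1 z.2 :=
      hv.continuous.comp (continuous_fst.prodMk (continuous_subtype_val.comp continuous_snd))
    have h1 := (hf.continuous_dx p).comp h0
    have h2 := (hf.continuous_dp p).comp h0
    have h3 := (hf.continuous p).comp h0
    have h4 := h1.clm_apply (map_continuous x.1.1.1)
    have h5 := h2.clm_apply (continuous_const (y := x.2.2.2))
    exact (((map_continuous x.1.1.2).sub (h4.const_smul T)).sub (h3.const_smul x.2.1)).sub
      (h5.const_smul T)

/-- The second linearized equation:
`δ_bc = δ_v(· + ρ, 0) - δ_v(·, 1) + ∂_φ v(· + ρ, 0) δ_ρ`. -/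
noncomputable def linBc (ρ : ℝ) {v : Circ → ℝ → Vec n} (hv : IsC1 v) (x : Unknowns n q) :
    C(Circ, Vec n) where
  toFun φ := x.1.1.1 (φ + (ρ : Circ), 0) - x.1.1.1 (φ, 1) + x.2.2.1 • dphi v (φ + (ρ : Circ)) 0
  continuous_toFun := by
    have hadd : Continuous fun φ : Circ => φ + (ρ : Circ) := by fun_prop
    have h := (hv.continuous_dphi 0).comp hadd
    have h0 : Continuous fun φ : Circ => ((φ + (ρ : Circ), 0) : Strip) := by fun_prop
    have h1 : Continuous fun φ : Circ => ((φ, 1) : Strip) := by fun_prop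
    exact (((map_continuous x.1.1.1).comp h0).sub ((map_continuous x.1.1.1).comp h1)).add (h.const_smul x.2.2.1)

/-- The third linearized equation: `δ_h = ∫_𝕊 ∫_0^1 ∂_v h δ_v dτ dφ + ∂_p h δ_p`. -/
noncomputable def linPs (K : Fin 2 → C(Strip, Cov n)) (H : Fin 2 → Cov q) (x : Unknowns n q) :
    EuclideanSpace ℝ (Fin 2) :=
  WithLp.toLp 2 fun i =>
    (∫ φ : Circ, ∫ τ : unitInterval, K i (φ, τ) (x.1.1.1 (φ, τ))) + H i x.2.2.2

theorem integral_strip (g : Strip → ℝ) (hg : Continuous g) :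
    ∫ φ : Circ, ∫ τ : unitInterval, g (φ, τ) = ∫ z : Strip, g z := by
  have hi : Integrable g (volume : Measure Strip) :=
    hg.integrable_of_hasCompactSupport (HasCompactSupport.of_compactSpace g)
  exact (integral_prod g hi).symm

theorem linPs_add (K : Fin 2 → C(Strip, Cov n)) (H : Fin 2 → Cov q) (x y : Unknowns n q) :
    linPs K H (x + y) = linPs K H x + linPs K H y := by
  have hc : ∀ (i : Fin 2) (w : C(Strip, Vec n)), Continuous fun z : Strip => K i z (w z) :=
    fun i w => (map_continuous (K i)).clm_apply (map_continuous w)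
  ext i
  have hi : ∀ w : C(Strip, Vec n), Integrable (fun z : Strip => K i z (w z)) :=
    fun w => (hc i w).integrable_of_hasCompactSupport (HasCompactSupport.of_compactSpace _)
  have key : ∀ w : C(Strip, Vec n), ∫ φ : Circ, ∫ τ : unitInterval, K i (φ, τ) (w (φ, τ)) =
      ∫ z : Strip, K i z (w z) := fun w => integral_strip _ (hc i w)
  have e := integral_add (hi x.1.1.1) (hi y.1.1.1)
  have e' : ∫ z : Strip, K i z ((x + y).1.1.1 z) =
      (∫ z : Strip, K i z (x.1.1.1 z)) + ∫ z : Strip, K i z (y.1.1.1 z) := by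
    rw [← e]
    exact integral_congr_ae (Filter.Eventually.of_forall fun z => map_add (K i z) _ _)
  simp only [linPs, PiLp.add_apply, key, e', Prod.snd_add, map_add]
  ring

theorem linPs_smul (K : Fin 2 → C(Strip, Cov n)) (H : Fin 2 → Cov q) (c : ℝ)
    (x : Unknowns n q) : linPs K H (c • x) = c • linPs K H x := by
  ext i
  have e : ∫ φ : Circ, ∫ τ : unitInterval, K i (φ, τ) ((c • x).1.1.1 (φ, τ)) =
      c * ∫ φ : Circ, ∫ τ : unitInterval, K i (φ, τ) (x.1.1.1 (φ, τ)) := by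
    rw [← integral_const_mul]
    refine integral_congr_ae (Filter.Eventually.of_forall fun φ => ?_)
    beta_reduce
    rw [← integral_const_mul]
    exact integral_congr_ae (Filter.Eventually.of_forall fun τ => map_smul (K i (φ, τ)) c _)
  simp only [linPs, PiLp.smul_apply, e, Prod.smul_snd, map_smul, smul_eq_mul]
  ring

/-- The linearization of the zero problem (boundary-value problem and phase conditions) at
`(v, T, ρ, p)`: the map `(δ_v, δ_T, δ_ρ, δ_p) ↦ (δ_ode, δ_bc, δ_h)`. -/
noncomputable def linZero {f : Vec n → Vec q → Vec n} (hf : IsC1Field f) (T ρ : ℝ) (p : Vec q)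
    {v : Circ → ℝ → Vec n} (hv : IsC1 v) (K : Fin 2 → C(Strip, Cov n)) (H : Fin 2 → Cov q) :
    Unknowns n q →ₗ[ℝ] Violations n where
  toFun x := (linOde hf T p hv x, linBc ρ hv x, linPs K H x)
  map_add' x y := by
    refine Prod.ext ?_ (Prod.ext ?_ (linPs_add K H x y))
    · ext1 z
      simp only [linOde, ContinuousMap.coe_mk, Prod.fst_add, Prod.snd_add, Submodule.coe_add,
        ContinuousMap.add_apply, map_add, smul_add, add_smul]
      abel
    · ext1 φ
      simp only [linBc, ContinuousMap.coe_mk, Prod.fst_add, Prod.snd_add, Submodule.coe_add,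
        ContinuousMap.add_apply, add_smul]
      abel
  map_smul' c x := by
    refine Prod.ext ?_ (Prod.ext ?_ (linPs_smul K H c x))
    · ext1 z
      simp only [linOde, ContinuousMap.coe_mk, Prod.smul_fst, Prod.smul_snd, Submodule.coe_smul,
        ContinuousMap.smul_apply, map_smul, smul_sub, RingHom.id_apply, smul_assoc,
        smul_comm T c]
    · ext1 φ
      simp only [linBc, ContinuousMap.coe_mk, Prod.smul_fst, Prod.smul_snd, Submodule.coe_smul,
        ContinuousMap.smul_apply, smul_sub, smul_add, RingHom.id_apply, smul_assoc]

/-- The linearization of the reduced continuation problem, in which `T` and `ρ` are free and the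
monitor function `p` is prescribed: `(δ_v, δ_T, δ_ρ, δ_p) ↦ ((δ_ode, δ_bc, δ_h), δ_p)`. -/
noncomputable def linReduced {f : Vec n → Vec q → Vec n} (hf : IsC1Field f) (T ρ : ℝ) (p : Vec q)
    {v : Circ → ℝ → Vec n} (hv : IsC1 v) (K : Fin 2 → C(Strip, Cov n)) (H : Fin 2 → Cov q) :
    Unknowns n q →ₗ[ℝ] Violations n × Vec q :=
  (linZero hf T ρ p hv K H).prod
    (LinearMap.snd ℝ ℝ (Vec q) ∘ₗ LinearMap.snd ℝ ℝ (ℝ × Vec q) ∘ₗ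
      LinearMap.snd ℝ (StripFun n) (ℝ × ℝ × Vec q))

/-- The adjoint conditions for `(λ_de, λ_bc, λ_ps, η_T, η_ρ, η_p)`, with `λ_bc` continuous;
`λ_de(φ, τ)` matters for `τ ∈ [0,1]` only. -/
structure IsAdjointSolution (f : Vec n → Vec q → Vec n) (T ρ : ℝ) (p : Vec q)
    (v : Circ → ℝ → Vec n) (K : Fin 2 → C(Strip, Cov n)) (H : Fin 2 → Cov q)
    (ldE : Circ → ℝ → Cov n) (lbc : C(Circ, Cov n)) (lps : Fin 2 → ℝ)
    (etaT etaρ : ℝ) (etap : Cov q) : Prop where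
  var_v : ∀ (φ : Circ) (τ : unitInterval), HasDerivWithinAt (ldE φ)
    (-(T • (ldE φ τ).comp (dx f (v φ τ) p)) + ∑ i, lps i • K i (φ, τ)) (Icc 0 1) (τ : ℝ)
  var_v1 : ∀ φ, 0 = ldE φ 1 - lbc φ
  var_v0 : ∀ φ, 0 = -ldE φ 0 + lbc (φ - (ρ : Circ))
  var_T : 0 = -(∫ φ : Circ, ∫ τ in (0 : ℝ)..1, ldE φ τ (f (v φ τ) p)) + etaT
  var_ρ : 0 = (∫ φ : Circ, lbc φ (dphi v (φ + (ρ : Circ)) 0)) + etaρ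
  var_p : 0 = -(∫ φ : Circ, ∫ τ in (0 : ℝ)..1, T • (ldE φ τ).comp (dp f (v φ τ) p)) + etap
    + ∑ i, lps i • H i

/-- The pairing `⟨λ, δΦ⟩ + ⟨η_p, δ_p⟩`. -/
noncomputable def adjointPairing (ldE : Circ → ℝ → Cov n) (lbc : C(Circ, Cov n))
    (lps : Fin 2 → ℝ) (etap : Cov q) (y : Violations n × Vec q) : ℝ :=
  (∫ φ : Circ, ∫ τ : unitInterval, ldE φ τ (y.1.1 (φ, τ))) + (∫ φ : Circ, lbc φ (y.1.2.1 φ))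
    + (∑ i, lps i * y.1.2.2 i) + etap y.2

end QPTorus

/-!
A covector field `r` with `r(φ, τ) V(φ, τ) = r(φ, 0)` and `r(φ, τ + 1) = r(φ + ρ, τ)` turns the
return map of the linearization into a scalar equation: with `a(φ) = r(φ, 0) δ_v(φ, 0)`,
`a(φ + ρ) - a(φ) = r(φ, 1) (δ_rhs + P(φ, 1) δ_p) + constants`, where the constants are the pairings
of `r` with the directions of `δ_T` and `δ_ρ`. Integrating over the circle gives the mean equations,
hence bounded rows for `δ_T` and `δ_ρ`; Fourier coefficients give the small divisors. Integrating by
parts in `τ`, the same invariance is the adjoint equation, and an adjoint solution that annihilates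
the tangent directions vanishes because the transversal return map is invertible.

The operator `g ↦ g(· + ρ) - g` has, modulo constants, dense range, which together with the
transversal inverse gives density of the range of `L`. It is not bounded below: if `kρ` is close
to `0`, then `φ ↦ g(kφ)` is almost invariant while its sup-norm is that of `g`. Since `g` may vary
in a space of any finite dimension, finitely many extra linear conditions do not help.
-/

namespace QPTorus

section LinearODE

variable {E : Type*} [NormedAddCommGroup E] [NormedSpace ℝ E]

theorem eq_zero_of_hasDerivAt_clm_apply {A : ℝ → E →L[ℝ] E} (hA : Continuous A) {y : ℝ → E}
    (hy : ∀ t, HasDerivAt y (A t (y t)) t) {t₀ : ℝ} (h0 : y t₀ = 0) (t : ℝ) : y t = 0 := by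
  obtain ⟨a, ha⟩ := exists_lt (min t t₀)
  obtain ⟨b, hb⟩ := exists_gt (max t t₀)
  obtain ⟨C, hC⟩ := (isCompact_Icc (a := a) (b := b)).exists_bound_of_continuousOn hA.continuousOn
  have hlip : ∀ s ∈ Ioo a b, LipschitzOnWith C.toNNReal (A s) univ := fun s hs =>
    ((A s).lipschitz.weaken (NNReal.coe_le_coe.1
      ((hC s (Ioo_subset_Icc_self hs)).trans (Real.le_coe_toNNReal C)))).lipschitzOnWith
  have hzero : ∀ s, HasDerivAt (fun _ => (0 : E)) (A s 0) s := fun s =>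
    (hasDerivAt_const s (0 : E)).congr_deriv (map_zero _).symm
  exact ODE_solution_unique_of_mem_Ioo hlip
    ⟨ha.trans_le (min_le_right _ _), (le_max_right _ _).trans_lt hb⟩
    (fun s _ => ⟨hy s, mem_univ _⟩) (fun s _ => ⟨hzero s, mem_univ _⟩) h0
    ⟨ha.trans_le (min_le_left _ _), (le_max_left _ _).trans_lt hb⟩

theorem hasDerivAt_intervalIntegral_of_continuous {F F' : ℝ → ℝ → E}
    (hF : Continuous ↿F) (hF' : Continuous ↿F')
    (h : ∀ x t, HasDerivAt (fun x => F x t) (F' x t) x) (a b x₀ : ℝ) :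
    HasDerivAt (fun x => ∫ t in a..b, F x t) (∫ t in a..b, F' x₀ t) x₀ := by
  obtain ⟨C, hC⟩ := ((isCompact_closedBall x₀ 1).prod (isCompact_uIcc (a := a) (b := b))
    ).exists_bound_of_continuousOn hF'.continuousOn
  exact (intervalIntegral.hasDerivAt_integral_of_dominated_loc_of_deriv_le
    (bound := fun _ => C) (Metric.closedBall_mem_nhds x₀ one_pos)
    (.of_forall fun x => (hF.uncurry_left x).aestronglyMeasurable)
    ((hF.uncurry_left x₀).intervalIntegrable _ _)
    (hF'.uncurry_left x₀).aestronglyMeasurable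
    (.of_forall fun t ht x hx => hC (x, t) ⟨hx, uIoc_subset_uIcc ht⟩)
    intervalIntegrable_const
    (.of_forall fun t _ x _ => h x t)).2

variable [CompleteSpace E]

theorem hasDerivAt_partial_comm {F D G G' : ℝ → ℝ → E} (hG : Continuous ↿G)
    (hG' : Continuous ↿G') (hFt : ∀ x t, HasDerivAt (F x) (G x t) t)
    (hFx : ∀ x t, HasDerivAt (fun y => F y t) (D x t) x)
    (hGx : ∀ x t, HasDerivAt (fun y => G y t) (G' x t) x) (x t : ℝ) :
    HasDerivAt (D x) (G' x t) t := by
  have hF : ∀ y s, F y s = F y 0 + ∫ σ in (0 : ℝ)..s, G y σ := fun y s => by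
    rw [intervalIntegral.integral_eq_sub_of_hasDerivAt (fun σ _ => hFt y σ)
      ((hG.uncurry_left y).intervalIntegrable _ _), add_sub_cancel]
  have hD : D x = fun s => D x 0 + ∫ σ in (0 : ℝ)..s, G' x σ := funext fun s =>
    (hFx x s).unique <| ((hFx x 0).add
      (hasDerivAt_intervalIntegral_of_continuous hG hG' hGx 0 s x)).congr_of_eventuallyEq <|
      .of_forall fun y => hF y s
  rw [hD]
  exact (intervalIntegral.integral_hasDerivAt_right ((hG'.uncurry_left x).intervalIntegrable 0 t)
    ((hG'.uncurry_left x).stronglyMeasurableAtFilter _ _)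
    (hG'.uncurry_left x).continuousAt).const_add _

theorem intervalIntegral_eq_sub_of_hasDerivWithinAt {a b : ℝ} (hab : a ≤ b) {w g : ℝ → E}
    (hg : ContinuousOn g (Icc a b))
    (hw : ∀ s ∈ Icc a b, HasDerivWithinAt w (g s) (Icc a b) s) :
    ∫ s in a..b, g s = w b - w a :=
  intervalIntegral.integral_eq_sub_of_hasDerivAt_of_le hab
    (fun s hs => (hw s hs).continuousWithinAt)
    (fun s hs => (hw s (Ioo_subset_Icc_self hs)).hasDerivAt (Icc_mem_nhds hs.1 hs.2))
    (ContinuousOn.intervalIntegrable_of_Icc hab hg)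

end LinearODE

/-- `V` is the fundamental solution, normalized at `τ = 0`, of the linear differential equation
`∂_τ y = A(φ, τ) y`, whose coefficients depend continuously on `τ` and on a parameter `φ`. -/
structure IsFundamental {X E : Type*} [TopologicalSpace X] [NormedAddCommGroup E]
    [NormedSpace ℝ E] (A V : X → ℝ → E →L[ℝ] E) : Prop where
  cont : Continuous fun z : X × ℝ => A z.1 z.2
  init : ∀ φ, V φ 0 = ContinuousLinearMap.id ℝ E
  ode : ∀ φ τ, HasDerivAt (V φ) ((A φ τ).comp (V φ τ)) τ

namespace IsFundamental

variable {X E : Type*} [TopologicalSpace X] [NormedAddCommGroup E] [NormedSpace ℝ E]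
  {A V : X → ℝ → E →L[ℝ] E}

theorem continuous_right (hV : IsFundamental A V) (φ : X) : Continuous (V φ) :=
  continuous_iff_continuousAt.2 fun τ => (hV.ode φ τ).continuousAt

theorem continuous_coeff_right (hV : IsFundamental A V) (φ : X) : Continuous (A φ) :=
  hV.cont.comp (by fun_prop : Continuous fun t : ℝ => (φ, t))

theorem hasDerivAt_apply (hV : IsFundamental A V) (φ : X) (τ : ℝ) (x : E) :
    HasDerivAt (fun t => V φ t x) (A φ τ (V φ τ x)) τ :=
  ((hV.ode φ τ).clm_apply (hasDerivAt_const τ x)).congr_deriv (by simp)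

theorem apply_eq_of_hasDerivAt (hV : IsFundamental A V) {φ : X} {y : ℝ → E}
    (hy : ∀ t, HasDerivAt y (A φ t (y t)) t) (τ : ℝ) : V φ τ (y 0) = y τ :=
  sub_eq_zero.1 <| eq_zero_of_hasDerivAt_clm_apply (y := fun t => V φ t (y 0) - y t)
    (hV.continuous_coeff_right φ)
    (fun t => ((hV.hasDerivAt_apply φ t _).sub (hy t)).congr_deriv (map_sub _ _ _).symm)
    (t₀ := 0) (by simp [hV.init]) τ

theorem norm_sub_le_gronwallBound (hV : IsFundamental A V) {φ φ₀ : X} {a δ c : ℝ}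
    (ha : ∀ τ ∈ Icc (0 : ℝ) 1, ‖A φ τ‖ ≤ a)
    (hδ : ∀ τ ∈ Icc (0 : ℝ) 1, ‖A φ τ - A φ₀ τ‖ ≤ δ)
    (hc : ∀ τ ∈ Icc (0 : ℝ) 1, ‖V φ₀ τ‖ ≤ c) {τ : ℝ} (hτ : τ ∈ Icc (0 : ℝ) 1) :
    ‖V φ τ - V φ₀ τ‖ ≤ gronwallBound 0 a (δ * c) τ := by
  have hderiv : ∀ t ∈ Ico (0 : ℝ) 1,
      ‖(A φ t).comp (V φ t) - (A φ₀ t).comp (V φ₀ t)‖ ≤ a * ‖V φ t - V φ₀ t‖ + δ * c := by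
    intro t ht
    have ht' : t ∈ Icc (0 : ℝ) 1 := Ico_subset_Icc_self ht
    calc ‖(A φ t).comp (V φ t) - (A φ₀ t).comp (V φ₀ t)‖
        = ‖(A φ t).comp (V φ t - V φ₀ t) + (A φ t - A φ₀ t).comp (V φ₀ t)‖ := by
          rw [ContinuousLinearMap.comp_sub, ContinuousLinearMap.sub_comp, sub_add_sub_cancel]
      _ ≤ ‖A φ t‖ * ‖V φ t - V φ₀ t‖ + ‖A φ t - A φ₀ t‖ * ‖V φ₀ t‖ :=
          (norm_add_le _ _).trans (add_le_add (ContinuousLinearMap.opNorm_comp_le _ _)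
            (ContinuousLinearMap.opNorm_comp_le _ _))
      _ ≤ a * ‖V φ t - V φ₀ t‖ + δ * c := by
          gcongr
          exacts [ha t ht', (norm_nonneg _).trans (hδ t ht'), hδ t ht', hc t ht']
  simpa using norm_le_gronwallBound_of_norm_deriv_right_le
    ((hV.continuous_right φ).sub (hV.continuous_right φ₀)).continuousOn
    (fun t _ => ((hV.ode φ t).sub (hV.ode φ₀ t)).hasDerivWithinAt)
    (by simp [hV.init]) hderiv τ hτ

theorem continuous (hV : IsFundamental A V) :
    Continuous fun z : X × unitInterval => V z.1 z.2 := by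
  let A' : X → C(unitInterval, E →L[ℝ] E) := fun φ =>
    ⟨fun τ => A φ τ, (hV.continuous_coeff_right φ).comp continuous_subtype_val⟩
  let V' : X → C(unitInterval, E →L[ℝ] E) := fun φ =>
    ⟨fun τ => V φ τ, (hV.continuous_right φ).comp continuous_subtype_val⟩
  have hA' : Continuous A' := ContinuousMap.continuous_of_continuous_uncurry _
    (hV.cont.comp (continuous_fst.prodMk (continuous_subtype_val.comp continuous_snd)))
  suffices hV' : Continuous V' from ContinuousMap.continuous_uncurry_of_continuous ⟨V', hV'⟩
  refine continuous_iff_continuousAt.2 fun φ₀ => ?_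
  have hdist : Continuous fun φ => dist (A' φ) (A' φ₀) := by fun_prop
  have hbound : ∀ᶠ φ in nhds φ₀, dist (V' φ) (V' φ₀) ≤
      gronwallBound 0 (‖A' φ₀‖ + 1) (dist (A' φ) (A' φ₀) * ‖V' φ₀‖) 1 := by
    filter_upwards [(hdist.tendsto' φ₀ 0 (dist_self _)).eventually_le_const one_pos] with φ hφ
    have hmono := gronwallBound_mono (δ := 0) (ε := dist (A' φ) (A' φ₀) * ‖V' φ₀‖)
      (K := ‖A' φ₀‖ + 1) le_rfl (by positivity) (by positivity)
    have hA : ∀ t ∈ Icc (0 : ℝ) 1, ‖A φ t - A φ₀ t‖ ≤ dist (A' φ) (A' φ₀) := fun t ht =>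
      (dist_eq_norm _ _).symm.trans_le
        (ContinuousMap.dist_apply_le_dist (f := A' φ) (g := A' φ₀) (⟨t, ht⟩ : unitInterval))
    refine (ContinuousMap.dist_le_iff_of_nonempty).2 fun τ => ?_
    rw [dist_eq_norm]
    exact (hV.norm_sub_le_gronwallBound
      (fun t ht => (norm_le_norm_add_norm_sub' _ _).trans
        (add_le_add ((A' φ₀).norm_coe_le_norm ⟨t, ht⟩) ((hA t ht).trans hφ)))
      hA (fun t ht => (V' φ₀).norm_coe_le_norm ⟨t, ht⟩) τ.2).trans (hmono τ.2.2)
  have hlim : Filter.Tendsto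
      (fun φ => gronwallBound 0 (‖A' φ₀‖ + 1) (dist (A' φ) (A' φ₀) * ‖V' φ₀‖) 1)
      (nhds φ₀) (nhds 0) :=
    ((gronwallBound_continuous_ε 0 _ 1).comp (hdist.mul_const _)).tendsto' φ₀ 0 (by
      simp only [Function.comp_apply, dist_self, zero_mul, gronwallBound_ε0_δ0])
  exact tendsto_iff_dist_tendsto_zero.2
    (squeeze_zero' (.of_forall fun _ => dist_nonneg) hbound hlim)

variable [FiniteDimensional ℝ E]

theorem isInvertible (hV : IsFundamental A V) (φ : X) (τ : ℝ) : (V φ τ).IsInvertible := by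
  have hinj : Function.Injective (V φ τ) := (injective_iff_map_eq_zero _).2 fun x hx => by
    simpa [hV.init φ] using eq_zero_of_hasDerivAt_clm_apply (hV.continuous_coeff_right φ)
      (fun t => hV.hasDerivAt_apply φ t x) hx 0
  exact ⟨(LinearEquiv.ofInjectiveEndo (V φ τ : E →ₗ[ℝ] E) hinj).toContinuousLinearEquiv, rfl⟩

theorem hasDerivAt_inverse (hV : IsFundamental A V) (φ : X) (τ : ℝ) :
    HasDerivAt (fun t => (V φ t).inverse) (-((V φ τ).inverse.comp (A φ τ))) τ := by
  have := FiniteDimensional.complete ℝ E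
  obtain ⟨e, he⟩ := hV.isInvertible φ τ
  have hderiv : HasFDerivAt ContinuousLinearMap.inverse
      (-ContinuousLinearMap.mulLeftRight ℝ (E →L[ℝ] E) e.symm e.symm) (V φ τ) := by
    rw [← ContinuousLinearMap.ringInverse_eq_inverse, ← he]
    exact hasFDerivAt_ringInverse (ContinuousLinearEquiv.toUnit e)
  refine (hderiv.comp_hasDerivAt τ (hV.ode φ τ)).congr_deriv ?_
  ext1 x
  simp [← he, ContinuousLinearMap.mulLeftRight_apply]

theorem continuous_inverse (hV : IsFundamental A V) :
    Continuous fun z : X × unitInterval => (V z.1 z.2).inverse := by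
  have := FiniteDimensional.complete ℝ E
  exact continuous_iff_continuousAt.2 fun z => ContinuousAt.comp
    (f := fun z : X × unitInterval => V z.1 z.2)
    ((hV.isInvertible z.1 z.2).contDiffAt_map_inverse (n := 0)).continuousAt
    hV.continuous.continuousAt

end IsFundamental

section InvariantFields

variable {E : Type*} [NormedAddCommGroup E] [NormedSpace ℝ E]

/-- A continuous vector field `e` along the torus that solves the linear differential equation
`∂_τ e = A e` and is compatible with the identification `(φ, τ + 1) ∼ (φ + ρ, τ)`; the tangent
fields `∂_τ v` and `∂_φ v` are the examples. -/
structure IsTangent (ρ : ℝ) (A : Circ → ℝ → E →L[ℝ] E) (e : Circ → ℝ → E) : Prop where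
  cont : Continuous fun z : Circ × ℝ => e z.1 z.2
  ode : ∀ φ τ, HasDerivAt (e φ) (A φ τ (e φ τ)) τ
  shift : ∀ φ τ, e φ (τ + 1) = e (φ + (ρ : Circ)) τ

/-- A continuous field `r` of linear functionals along the torus that is invariant under the
fundamental solution `V` and compatible with the identification `(φ, τ + 1) ∼ (φ + ρ, τ)`; the
rows `q_τ` and `q_φ` of the tangential projection are the examples. -/
structure IsCotangent (ρ : ℝ) (V : Circ → ℝ → E →L[ℝ] E) (r : Circ → ℝ → E →L[ℝ] ℝ) : Prop where
  cont : Continuous fun z : Circ × ℝ => r z.1 z.2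
  inv : ∀ φ τ x, r φ τ (V φ τ x) = r φ 0 x
  shift : ∀ φ τ, r φ (τ + 1) = r (φ + (ρ : Circ)) τ

variable {ρ : ℝ} {A V : Circ → ℝ → E →L[ℝ] E} {e : Circ → ℝ → E} {r : Circ → ℝ → E →L[ℝ] ℝ}

theorem IsTangent.const_smul (he : IsTangent ρ A e) (c : ℝ) :
    IsTangent ρ A fun φ τ => c • e φ τ where
  cont := he.cont.const_smul c
  ode φ τ := ((he.ode φ τ).const_smul c).congr_deriv (map_smul _ _ _).symm
  shift φ τ := congr_arg (c • ·) (he.shift φ τ)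

theorem IsTangent.add {e' : Circ → ℝ → E} (he : IsTangent ρ A e) (he' : IsTangent ρ A e') :
    IsTangent ρ A fun φ τ => e φ τ + e' φ τ where
  cont := he.cont.add he'.cont
  ode φ τ := ((he.ode φ τ).add (he'.ode φ τ)).congr_deriv (map_add _ _ _).symm
  shift φ τ := congr_arg₂ (· + ·) (he.shift φ τ) (he'.shift φ τ)

theorem IsTangent.map_eq (he : IsTangent ρ A e) (hV : IsFundamental A V) (φ : Circ) (τ : ℝ) :
    V φ τ (e φ 0) = e φ τ :=
  hV.apply_eq_of_hasDerivAt (he.ode φ) τ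

theorem IsTangent.map_one (he : IsTangent ρ A e) (hV : IsFundamental A V) (φ : Circ) :
    V φ 1 (e φ 0) = e (φ + (ρ : Circ)) 0 := by
  rw [he.map_eq hV, ← he.shift, zero_add]

theorem IsTangent.continuous_zero (he : IsTangent ρ A e) : Continuous fun φ : Circ => e φ 0 :=
  he.cont.comp (by fun_prop : Continuous fun φ : Circ => (φ, (0 : ℝ)))

theorem IsCotangent.continuous_zero (hr : IsCotangent ρ V r) :
    Continuous fun φ : Circ => r φ 0 :=
  hr.cont.comp (by fun_prop : Continuous fun φ : Circ => (φ, (0 : ℝ)))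

theorem IsCotangent.continuous_one (hr : IsCotangent ρ V r) :
    Continuous fun φ : Circ => r φ 1 :=
  hr.cont.comp (by fun_prop : Continuous fun φ : Circ => (φ, (1 : ℝ)))

theorem IsCotangent.apply_one (hr : IsCotangent ρ V r) (φ : Circ) :
    r φ 1 = r (φ + (ρ : Circ)) 0 := by
  rw [← hr.shift, zero_add]

theorem IsCotangent.apply_sub_one (hr : IsCotangent ρ V r) (φ : Circ) :
    r (φ - (ρ : Circ)) 1 = r φ 0 := by
  rw [hr.apply_one, sub_add_cancel]

theorem IsCotangent.map_one (hr : IsCotangent ρ V r) (φ : Circ) (x : E) :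
    r (φ + (ρ : Circ)) 0 (V φ 1 x) = r φ 0 x := by
  rw [← hr.apply_one, hr.inv]

theorem IsCotangent.hasDerivAt [FiniteDimensional ℝ E] (hr : IsCotangent ρ V r)
    (hV : IsFundamental A V) (φ : Circ) (τ : ℝ) :
    HasDerivAt (r φ) (-((r φ τ).comp (A φ τ))) τ := by
  have hr_eq : r φ = fun t => (r φ 0).comp (V φ t).inverse := by
    ext t x
    rw [ContinuousLinearMap.comp_apply, ← hr.inv φ t, (hV.isInvertible φ t).self_apply_inverse]
  rw [hr_eq]
  exact ((hasDerivAt_const τ (r φ 0)).clm_comp (hV.hasDerivAt_inverse φ τ)).congr_deriv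
    (by ext1 x; simp)

end InvariantFields

section Torus

variable {n q : ℕ} {f : Vec n → Vec q → Vec n} {T ρ : ℝ} {p : Vec q} {v : Circ → ℝ → Vec n}
  {V : Circ → ℝ → Vec n →L[ℝ] Vec n} {qτ qφ : Circ → ℝ → Cov n}

/-- The coefficient `T ∂_x f(v, p)` of the variational equation. -/
noncomputable def coeff (f : Vec n → Vec q → Vec n) (T : ℝ) (p : Vec q) (v : Circ → ℝ → Vec n)
    (φ : Circ) (τ : ℝ) : Vec n →L[ℝ] Vec n :=
  T • dx f (v φ τ) p

theorem continuous_coeff (hf : IsC1Field f) (hv : IsC1 v) :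
    Continuous fun z : Circ × ℝ => coeff f T p v z.1 z.2 :=
  ((hf.continuous_dx p).comp hv.continuous).const_smul T

theorem IsVariationalSolution.isFundamental (hV : IsVariationalSolution f T p v V)
    (hf : IsC1Field f) (hv : IsC1 v) : IsFundamental (coeff f T p v) V :=
  ⟨continuous_coeff hf hv, hV.init, hV.ode⟩

theorem IsC1Field.hasFDerivAt (hf : IsC1Field f) (x : Vec n) (p : Vec q) :
    HasFDerivAt (fun y => f y p) (dx f x p) x :=
  ((ContDiff.comp (g := fun z : Vec n × Vec q => f z.1 z.2) hf
    (contDiff_id.prodMk contDiff_const)).differentiable one_ne_zero x).hasFDerivAt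

theorem IsC1.hasDerivAt_dphi (hv : IsC1 v) (x τ : ℝ) :
    HasDerivAt (fun y : ℝ => v (y : Circ) τ) (dphi v (x : Circ) τ) x := by
  have hdiff : DifferentiableAt ℝ (fun y : ℝ => v (y : Circ) τ) x :=
    (ContDiff.comp (g := fun z : ℝ × ℝ => v (z.1 : Circ) z.2) hv
      (contDiff_id.prodMk contDiff_const)).differentiable one_ne_zero x
  refine hdiff.hasDerivAt.congr_deriv ?_
  simpa [dphi] using (deriv_comp_const_add (fun y : ℝ => v (y : Circ) τ) x 0).symm

theorem IsC1.continuous_uncurry_dphi (hv : IsC1 v) :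
    Continuous fun z : Circ × ℝ => dphi v z.1 z.2 := by
  have hquot : IsOpenQuotientMap (Prod.map (fun x : ℝ => (x : Circ)) (id : ℝ → ℝ)) :=
    (QuotientAddGroup.isOpenQuotientMap_mk).prodMap IsOpenQuotientMap.id
  refine hquot.isQuotientMap.continuous_iff.2 ?_
  have hv' : ContDiff ℝ 1 fun z : ℝ × ℝ => v (z.1 : Circ) z.2 := hv
  have hdphi : (fun z : Circ × ℝ => dphi v z.1 z.2) ∘ Prod.map (fun x : ℝ => (x : Circ)) id =
      fun z : ℝ × ℝ => fderiv ℝ (fun z : ℝ × ℝ => v (z.1 : Circ) z.2) z (1, 0) := funext fun z =>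
    (hv.hasDerivAt_dphi z.1 z.2).unique
      ((hv'.differentiable one_ne_zero z).hasFDerivAt.comp_hasDerivAt (f := (·, z.2)) z.1
        ((hasDerivAt_id z.1).prodMk (hasDerivAt_const z.1 z.2)))
  rw [hdphi]
  exact (hv'.continuous_fderiv one_ne_zero).clm_apply continuous_const

namespace IsTorusSolution

theorem dtau_eq (hv : IsTorusSolution f T ρ p v) (φ : Circ) (τ : ℝ) :
    dtau v φ τ = T • f (v φ τ) p :=
  (hv.ode φ τ).deriv

theorem isTangent_field (hv : IsTorusSolution f T ρ p v) (hf : IsC1Field f) :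
    IsTangent ρ (coeff f T p v) fun φ τ => f (v φ τ) p where
  cont := (hf.continuous p).comp hv.c1.continuous
  ode φ τ := ((hf.hasFDerivAt (v φ τ) p).comp_hasDerivAt τ (hv.ode φ τ)).congr_deriv
    (map_smul _ _ _)
  shift φ τ := by rw [hv.bc]

theorem isTangent_dtau (hv : IsTorusSolution f T ρ p v) (hf : IsC1Field f) :
    IsTangent ρ (coeff f T p v) (dtau v) := by
  rw [show dtau v = fun φ τ => T • f (v φ τ) p from funext₂ hv.dtau_eq]
  exact (hv.isTangent_field hf).const_smul T

theorem isTangent_dphi (hv : IsTorusSolution f T ρ p v) (hf : IsC1Field f) :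
    IsTangent ρ (coeff f T p v) (dphi v) where
  cont := hv.c1.continuous_uncurry_dphi
  ode φ τ := by
    obtain ⟨x, rfl⟩ := QuotientAddGroup.mk_surjective φ
    have hcoe : Continuous fun z : ℝ × ℝ => ((z.1 : Circ), z.2) :=
      ((AddCircle.continuous_mk' 1).comp continuous_fst).prodMk continuous_snd
    have hfield : Continuous ↿fun x σ : ℝ => T • f (v (x : Circ) σ) p :=
      (((hf.continuous p).comp hv.c1.continuous).const_smul T).comp hcoe
    have hfield' : Continuous
        ↿fun x σ : ℝ => coeff f T p v (x : Circ) σ (dphi v (x : Circ) σ) :=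
      ((continuous_coeff hf hv.c1).clm_apply hv.c1.continuous_uncurry_dphi).comp hcoe
    exact hasDerivAt_partial_comm hfield hfield' (fun y σ => hv.ode (y : Circ) σ)
      (fun y σ => hv.c1.hasDerivAt_dphi y σ)
      (fun y σ => ((hf.hasFDerivAt _ p).comp_hasDerivAt y
        (hv.c1.hasDerivAt_dphi y σ)).const_smul T) x τ
  shift φ τ := by simp only [dphi, hv.bc, add_right_comm]

end IsTorusSolution

theorem qtg_apply (φ : Circ) (τ : ℝ) (x : Vec n) :
    qtg v qτ qφ φ τ x = qτ φ τ x • dtau v φ τ + qφ φ τ x • dphi v φ τ := rfl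

namespace IsNormallyHyperbolic

theorem eq_and_eq_of_tangent_eq (hq : IsNormallyHyperbolic ρ v V qτ qφ) {φ : Circ}
    {τ a b a' b' : ℝ}
    (h : a • dtau v φ τ + b • dphi v φ τ = a' • dtau v φ τ + b' • dphi v φ τ) :
    a = a' ∧ b = b' := by
  obtain ⟨ha, hb⟩ := LinearIndependent.pair_iff.1 (hq.indep φ τ) (a - a') (b - b') (by
    rw [sub_smul, sub_smul, sub_add_sub_comm, h, sub_self])
  exact ⟨sub_eq_zero.1 ha, sub_eq_zero.1 hb⟩

theorem qtg_tangent (hq : IsNormallyHyperbolic ρ v V qτ qφ) (φ : Circ) (τ a b : ℝ) :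
    qtg v qτ qφ φ τ (a • dtau v φ τ + b • dphi v φ τ) = a • dtau v φ τ + b • dphi v φ τ := by
  obtain ⟨y, hy⟩ : a • dtau v φ τ + b • dphi v φ τ ∈ Set.range (qtg v qτ qφ φ τ) := by
    rw [hq.range_eq]
    exact Submodule.mem_span_pair.2 ⟨a, b, rfl⟩
  rw [← hy]
  exact DFunLike.congr_fun (hq.proj φ τ) y

theorem qτ_tangent (hq : IsNormallyHyperbolic ρ v V qτ qφ) (φ : Circ) (τ a b : ℝ) :
    qτ φ τ (a • dtau v φ τ + b • dphi v φ τ) = a :=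
  (hq.eq_and_eq_of_tangent_eq (hq.qtg_tangent φ τ a b)).1

theorem qφ_tangent (hq : IsNormallyHyperbolic ρ v V qτ qφ) (φ : Circ) (τ a b : ℝ) :
    qφ φ τ (a • dtau v φ τ + b • dphi v φ τ) = b :=
  (hq.eq_and_eq_of_tangent_eq (hq.qtg_tangent φ τ a b)).2

theorem apply_fundamental (hq : IsNormallyHyperbolic ρ v V qτ qφ) (hf : IsC1Field f)
    (hv : IsTorusSolution f T ρ p v) (hV : IsVariationalSolution f T p v V) (φ : Circ) (τ : ℝ)
    (x : Vec n) : qτ φ τ (V φ τ x) = qτ φ 0 x ∧ qφ φ τ (V φ τ x) = qφ φ 0 x := by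
  have hV' := hV.isFundamental hf hv.c1
  refine hq.eq_and_eq_of_tangent_eq (φ := φ) (τ := τ) ?_
  simpa only [ContinuousLinearMap.comp_apply, qtg_apply, map_add, map_smul,
    (hv.isTangent_dtau hf).map_eq hV', (hv.isTangent_dphi hf).map_eq hV'] using
    DFunLike.congr_fun (hq.invariant φ τ) x

theorem apply_add_one (hq : IsNormallyHyperbolic ρ v V qτ qφ) (hf : IsC1Field f)
    (hv : IsTorusSolution f T ρ p v) (φ : Circ) (τ : ℝ) (x : Vec n) :
    qτ φ (τ + 1) x = qτ (φ + (ρ : Circ)) τ x ∧ qφ φ (τ + 1) x = qφ (φ + (ρ : Circ)) τ x := by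
  refine hq.eq_and_eq_of_tangent_eq (φ := φ + (ρ : Circ)) (τ := τ) ?_
  simpa only [qtg_apply, (hv.isTangent_dtau hf).shift, (hv.isTangent_dphi hf).shift] using
    DFunLike.congr_fun (hq.shift φ τ) x

theorem T_ne_zero (hq : IsNormallyHyperbolic ρ v V qτ qφ)
    (hv : IsTorusSolution f T ρ p v) : T ≠ 0 := by
  rintro rfl
  have hdtau : dtau v 0 0 = 0 := by rw [hv.dtau_eq, zero_smul]
  exact (hq.indep 0 0).ne_zero 0 hdtau

end IsNormallyHyperbolic

/-- A cotangent field whose (constant) pairings with the tangent fields `f(v, p)` and `∂_φ v` are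
those of the adjoint variable `λ_de` for the data `(η_T, η_ρ)`. -/
structure IsAdjointField (f : Vec n → Vec q → Vec n) (ρ : ℝ) (p : Vec q) (v : Circ → ℝ → Vec n)
    (V : Circ → ℝ → Vec n →L[ℝ] Vec n) (r : Circ → ℝ → Cov n) (etaT etaρ : ℝ) : Prop
    extends IsCotangent ρ V r where
  apply_field : ∀ φ τ, r φ τ (f (v φ τ) p) = etaT
  apply_dphi : ∀ φ τ, r φ τ (dphi v φ τ) = -etaρ

theorem IsAdjointField.const_smul {r : Circ → ℝ → Cov n} {etaT etaρ : ℝ}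
    (hr : IsAdjointField f ρ p v V r etaT etaρ) (c : ℝ) :
    IsAdjointField f ρ p v V (fun φ τ => c • r φ τ) (c * etaT) (c * etaρ) where
  cont := hr.cont.const_smul c
  inv φ τ x := congr_arg (c * ·) (hr.inv φ τ x)
  shift φ τ := congr_arg (c • ·) (hr.shift φ τ)
  apply_field φ τ := congr_arg (c * ·) (hr.apply_field φ τ)
  apply_dphi φ τ := (congr_arg (c * ·) (hr.apply_dphi φ τ)).trans (mul_neg _ _)

theorem IsNormallyHyperbolic.isAdjointField_qτ (hq : IsNormallyHyperbolic ρ v V qτ qφ)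
    (hf : IsC1Field f) (hv : IsTorusSolution f T ρ p v) (hV : IsVariationalSolution f T p v V) :
    IsAdjointField f ρ p v V qτ T⁻¹ 0 where
  cont := hq.cont_qτ
  inv φ τ x := (hq.apply_fundamental hf hv hV φ τ x).1
  shift φ τ := ContinuousLinearMap.ext fun x => (hq.apply_add_one hf hv φ τ x).1
  apply_field φ τ := by
    simpa [hv.dtau_eq, hq.T_ne_zero hv] using hq.qτ_tangent φ τ T⁻¹ 0
  apply_dphi φ τ := by simpa using hq.qτ_tangent φ τ 0 1

theorem IsNormallyHyperbolic.isAdjointField_qφ (hq : IsNormallyHyperbolic ρ v V qτ qφ)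
    (hf : IsC1Field f) (hv : IsTorusSolution f T ρ p v) (hV : IsVariationalSolution f T p v V) :
    IsAdjointField f ρ p v V qφ 0 (-1) where
  cont := hq.cont_qφ
  inv φ τ x := (hq.apply_fundamental hf hv hV φ τ x).2
  shift φ τ := ContinuousLinearMap.ext fun x => (hq.apply_add_one hf hv φ τ x).2
  apply_field φ τ := by
    simpa [hv.dtau_eq, hq.T_ne_zero hv] using hq.qφ_tangent φ τ T⁻¹ 0
  apply_dphi φ τ := by simpa using hq.qφ_tangent φ τ 0 1

end Torus

section Integrals

variable {X E F : Type*} [TopologicalSpace X] [CompactSpace X] [MeasurableSpace X]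
  [OpensMeasurableSpace X] {μ : Measure X} [IsFiniteMeasureOnCompacts μ]
  [NormedAddCommGroup E] [NormedAddCommGroup F] [NormedSpace ℝ F]

theorem integrable_of_continuous {g : X → E} (hg : Continuous g) : Integrable g μ :=
  hg.integrable_of_hasCompactSupport (HasCompactSupport.of_compactSpace g)

theorem integral_unitInterval (g : ℝ → F) :
    ∫ σ : unitInterval, g σ = ∫ σ in (0 : ℝ)..1, g σ := by
  rw [intervalIntegral.integral_of_le zero_le_one, ← integral_Icc_eq_integral_Ioc]
  exact integral_subtype measurableSet_Icc g

theorem continuous_integral_unitInterval {g : Strip → F} (hg : Continuous g) :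
    Continuous fun φ : Circ => ∫ σ : unitInterval, g (φ, σ) := by
  simpa using continuous_parametric_integral_of_continuous (μ := (volume : Measure unitInterval))
    (f := fun φ σ => g (φ, σ)) hg isCompact_univ

theorem continuous_restrict_strip {Y : Type*} [TopologicalSpace Y] {g : Circ → ℝ → Y}
    (hg : Continuous fun z : Circ × ℝ => g z.1 z.2) : Continuous fun z : Strip => g z.1 z.2 :=
  hg.comp (by fun_prop : Continuous fun z : Strip => (z.1, (z.2 : ℝ)))

end Integrals

section ReturnMap

variable {n q : ℕ} {f : Vec n → Vec q → Vec n} {T ρ : ℝ} {p : Vec q} {v : Circ → ℝ → Vec n}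

theorem IsFundamental.hasDerivWithinAt_inverse_apply {X E : Type*} [TopologicalSpace X]
    [NormedAddCommGroup E] [NormedSpace ℝ E] [FiniteDimensional ℝ E] {A V : X → ℝ → E →L[ℝ] E}
    (hV : IsFundamental A V) {φ : X} {y : ℝ → E} {g : E} {s : Set ℝ} {τ : ℝ}
    (hy : HasDerivWithinAt y (A φ τ (y τ) + g) s τ) :
    HasDerivWithinAt (fun t => (V φ t).inverse (y t)) ((V φ τ).inverse g) s τ :=
  ((hV.hasDerivAt_inverse φ τ).hasDerivWithinAt.clm_apply hy).congr_deriv (by simp)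

theorem IsFundamental.variation_of_constants {X E : Type*} [TopologicalSpace X]
    [NormedAddCommGroup E] [NormedSpace ℝ E] [FiniteDimensional ℝ E] {A V : X → ℝ → E →L[ℝ] E}
    (hV : IsFundamental A V) {φ : X} {y g : ℝ → E} {τ : ℝ} (hτ : 0 ≤ τ)
    (hg : ContinuousOn g (Icc 0 τ))
    (hy : ∀ s ∈ Icc 0 τ, HasDerivWithinAt y (A φ s (y s) + g s) (Icc 0 τ) s) :
    y τ = V φ τ (y 0 + ∫ σ in (0 : ℝ)..τ, (V φ σ).inverse (g σ)) := by
  have := FiniteDimensional.complete ℝ E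
  have hinv : Continuous fun σ => (V φ σ).inverse :=
    continuous_iff_continuousAt.2 fun σ => (hV.hasDerivAt_inverse φ σ).continuousAt
  rw [intervalIntegral_eq_sub_of_hasDerivWithinAt hτ (hinv.continuousOn.clm_apply hg)
    fun s hs => hV.hasDerivWithinAt_inverse_apply (hy s hs)]
  simp only [hV.init φ, ContinuousLinearMap.inverse_id, ContinuousLinearMap.id_apply,
    add_sub_cancel, (hV.isInvertible φ τ).self_apply_inverse]

theorem hasDerivWithinAt_stripFun (w : StripFun n) (φ : Circ) {s : ℝ} (hs : s ∈ Icc (0 : ℝ) 1) :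
    HasDerivWithinAt (fun s => w.1.1 (φ, projIcc 0 1 zero_le_one s))
      (w.1.2 (φ, projIcc 0 1 zero_le_one s)) (Icc 0 1) s := by
  simpa only [projIcc_of_mem zero_le_one hs] using w.2 φ ⟨s, hs⟩

theorem IsFundamental.stripFun_eq_map {A V : Circ → ℝ → Vec n →L[ℝ] Vec n}
    (hV : IsFundamental A V) {w : StripFun n}
    (hw : ∀ z : Strip, w.1.2 z = A z.1 z.2 (w.1.1 z)) (φ : Circ) (τ : unitInterval) :
    w.1.1 (φ, τ) = V φ τ (w.1.1 (φ, 0)) := by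
  have h := hV.variation_of_constants (φ := φ) (g := 0) (τ := τ)
    (y := fun s => w.1.1 (φ, projIcc 0 1 zero_le_one s)) τ.2.1 continuousOn_const fun s hs => by
    have hs' : s ∈ Icc (0 : ℝ) 1 := ⟨hs.1, hs.2.trans τ.2.2⟩
    refine ((hasDerivWithinAt_stripFun w φ hs').mono (Icc_subset_Icc_right τ.2.2)).congr_deriv ?_
    rw [hw, projIcc_of_mem zero_le_one hs', Pi.zero_apply, add_zero]
  simpa only [projIcc_val, projIcc_left, Icc.mk_zero, Pi.zero_apply, map_zero,
    intervalIntegral.integral_zero, add_zero] using h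

theorem IsFundamental.stripFun_one {A V : Circ → ℝ → Vec n →L[ℝ] Vec n}
    (hV : IsFundamental A V) (w : StripFun n) (φ : Circ) :
    w.1.1 (φ, 1) = V φ 1 (w.1.1 (φ, 0) + ∫ σ : unitInterval,
      (V φ σ).inverse (w.1.2 (φ, σ) - A φ σ (w.1.1 (φ, σ)))) := by
  have hproj : Continuous fun σ : ℝ => ((φ, projIcc 0 1 zero_le_one σ) : Strip) :=
    continuous_const.prodMk continuous_projIcc
  have hg : Continuous fun σ : ℝ => w.1.2 (φ, projIcc 0 1 zero_le_one σ) -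
      A φ σ (w.1.1 (φ, projIcc 0 1 zero_le_one σ)) :=
    ((map_continuous w.1.2).comp hproj).sub
      ((hV.continuous_coeff_right φ).clm_apply ((map_continuous w.1.1).comp hproj))
  have h := hV.variation_of_constants (φ := φ)
    (y := fun s => w.1.1 (φ, projIcc 0 1 zero_le_one s)) zero_le_one hg.continuousOn fun s hs => by
    simpa only [add_sub_cancel] using hasDerivWithinAt_stripFun w φ hs
  rw [← integral_unitInterval] at h
  simpa only [projIcc_val, projIcc_left, projIcc_right, Icc.mk_zero, Icc.mk_one] using h

theorem IsVariationalSolution.continuous_one {V : Circ → ℝ → Vec n →L[ℝ] Vec n}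
    (hV : IsVariationalSolution f T p v V) (hf : IsC1Field f) (hv : IsC1 v) :
    Continuous fun φ => V φ 1 := by
  simpa only [Function.comp_def, Icc.coe_one] using
    (hV.isFundamental hf hv).continuous.comp (Continuous.prodMk_left 1)

variable {V : Circ → ℝ → Vec n →L[ℝ] Vec n}

/-- The inhomogeneity `δ_rhs(φ) + P(φ, 1) δ_p` that the data `(δ_ode, δ_bc, δ_p)` contribute to
the linearized return map `δ_v(φ, 0) ↦ δ_v(φ + ρ, 0)`. -/
noncomputable def returnRhs (f : Vec n → Vec q → Vec n) (T : ℝ) (p : Vec q)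
    (v : Circ → ℝ → Vec n) (V : Circ → ℝ → Vec n →L[ℝ] Vec n) (δode : C(Strip, Vec n))
    (δbc : C(Circ, Vec n)) (δp : Vec q) (φ : Circ) : Vec n :=
  deltaRhs V δode δbc φ + PMat f T p v V φ 1 δp

theorem continuous_strip_dp (hf : IsC1Field f) (hv : IsC1 v) :
    Continuous fun z : Strip => dp f (v z.1 z.2) p :=
  (hf.continuous_dp p).comp (continuous_restrict_strip hv.continuous)

theorem continuous_inverse_comp_dp (hf : IsC1Field f) (hv : IsC1 v)
    (hV : IsVariationalSolution f T p v V) :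
    Continuous fun z : Strip => (V z.1 z.2).inverse.comp (dp f (v z.1 z.2) p) :=
  (hV.isFundamental hf hv).continuous_inverse.clm_comp (continuous_strip_dp hf hv)

theorem continuous_inverse_apply (hf : IsC1Field f) (hv : IsC1 v)
    (hV : IsVariationalSolution f T p v V) (g : C(Strip, Vec n)) :
    Continuous fun z : Strip => (V z.1 z.2).inverse (g z) :=
  (hV.isFundamental hf hv).continuous_inverse.clm_apply (map_continuous g)

theorem continuous_deltaRhs (hf : IsC1Field f) (hv : IsC1 v)
    (hV : IsVariationalSolution f T p v V) (δode : C(Strip, Vec n)) (δbc : C(Circ, Vec n)) :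
    Continuous (deltaRhs V δode δbc) :=
  (map_continuous δbc).add ((hV.continuous_one hf hv).clm_apply
    (continuous_integral_unitInterval (continuous_inverse_apply hf hv hV δode)))

theorem PMat_one (φ : Circ) : PMat f T p v V φ 1 =
    T • (V φ 1).comp (∫ σ : unitInterval, (V φ σ).inverse.comp (dp f (v φ σ) p)) := by
  rw [PMat, integral_unitInterval fun σ => (V φ σ).inverse.comp (dp f (v φ σ) p)]

theorem continuous_PMat_one (hf : IsC1Field f) (hv : IsC1 v)
    (hV : IsVariationalSolution f T p v V) : Continuous fun φ => PMat f T p v V φ 1 := by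
  simp only [PMat_one]
  exact ((hV.continuous_one hf hv).clm_comp
    (continuous_integral_unitInterval (continuous_inverse_comp_dp hf hv hV))).const_smul T

theorem continuous_returnRhs (hf : IsC1Field f) (hv : IsC1 v)
    (hV : IsVariationalSolution f T p v V) (δode : C(Strip, Vec n)) (δbc : C(Circ, Vec n))
    (δp : Vec q) : Continuous (returnRhs f T p v V δode δbc δp) :=
  (continuous_deltaRhs hf hv hV δode δbc).add
    ((continuous_PMat_one hf hv hV).clm_apply continuous_const)

theorem returnRhs_eq (hf : IsC1Field f) (hv : IsC1 v)
    (hV : IsVariationalSolution f T p v V) (δode : C(Strip, Vec n)) (δbc : C(Circ, Vec n))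
    (δp : Vec q) (φ : Circ) :
    returnRhs f T p v V δode δbc δp φ = δbc φ + V φ 1 (∫ σ : unitInterval,
      (V φ σ).inverse (δode (φ, σ) + T • dp f (v φ σ) p δp)) := by
  have hode : Continuous fun σ : unitInterval => (V φ σ).inverse (δode (φ, σ)) :=
    (continuous_inverse_apply hf hv hV δode).comp (Continuous.prodMk_right φ)
  have hdp : Continuous fun σ : unitInterval => (V φ σ).inverse.comp (dp f (v φ σ) p) :=
    (continuous_inverse_comp_dp hf hv hV).comp (Continuous.prodMk_right φ)
  have hdp_apply : Continuous fun σ : unitInterval =>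
      T • (V φ σ).inverse.comp (dp f (v φ σ) p) δp :=
    (hdp.clm_apply continuous_const).const_smul T
  have hP : PMat f T p v V φ 1 δp = V φ 1 (∫ σ : unitInterval,
      T • (V φ σ).inverse.comp (dp f (v φ σ) p) δp) := by
    rw [PMat_one, integral_smul, map_smul,
      ← ContinuousLinearMap.integral_apply (integrable_of_continuous hdp)]
    rfl
  rw [returnRhs, deltaRhs, hP, add_assoc, ← map_add,
    ← integral_add (integrable_of_continuous hode) (integrable_of_continuous hdp_apply)]
  simp only [map_add, map_smul, ContinuousLinearMap.comp_apply]

theorem snd_sub_coeff_apply (hf : IsC1Field f) (hv : IsC1 v) (x : Unknowns n q) (z : Strip) :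
    x.1.1.2 z - coeff f T p v z.1 z.2 (x.1.1.1 z) =
      (linOde hf T p hv x z + T • dp f (v z.1 z.2) p x.2.2.2) + x.2.1 • f (v z.1 z.2) p := by
  simp only [linOde, ContinuousMap.coe_mk, coeff, smul_apply]
  abel

theorem return_map (hf : IsC1Field f) (hv : IsTorusSolution f T ρ p v)
    (hV : IsVariationalSolution f T p v V) (x : Unknowns n q) (φ : Circ) :
    x.1.1.1 (φ + (ρ : Circ), 0) = V φ 1 (x.1.1.1 (φ, 0))
      + returnRhs f T p v V (linOde hf T p hv.c1 x) (linBc ρ hv.c1 x) x.2.2.2 φ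
      + x.2.1 • f (v (φ + (ρ : Circ)) 0) p - x.2.2.1 • dphi v (φ + (ρ : Circ)) 0 := by
  have hV' := hV.isFundamental hf hv.c1
  set g : unitInterval → Vec n := fun σ =>
    (V φ σ).inverse (linOde hf T p hv.c1 x (φ, σ) + T • dp f (v φ σ) p x.2.2.2)
  have hg : Continuous g := by
    have hdp := (continuous_strip_dp (p := p) hf hv.c1).clm_apply
      (continuous_const (y := x.2.2.2))
    exact (hV'.continuous_inverse.clm_apply
      ((map_continuous _).add (hdp.const_smul T))).comp (Continuous.prodMk_right φ)
  have hforcing : ∀ σ : unitInterval, (V φ σ).inverse (x.1.1.2 (φ, σ) -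
      coeff f T p v φ σ (x.1.1.1 (φ, σ))) = g σ + x.2.1 • f (v φ 0) p := fun σ => by
    rw [snd_sub_coeff_apply hf hv.c1 x (φ, σ), map_add, map_smul,
      ← (hv.isTangent_field hf).map_eq hV' φ σ, (hV'.isInvertible φ σ).inverse_apply_self]
  have hone : x.1.1.1 (φ, 1) =
      V φ 1 (x.1.1.1 (φ, 0)) + V φ 1 (∫ σ, g σ) + x.2.1 • f (v (φ + (ρ : Circ)) 0) p := by
    rw [hV'.stripFun_one, integral_congr_ae (.of_forall hforcing),
      integral_add (integrable_of_continuous hg) (integrable_of_continuous continuous_const),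
      integral_const, probReal_univ, one_smul, map_add, map_add, map_smul,
      (hv.isTangent_field hf).map_one hV', add_assoc]
  have hbc : x.1.1.1 (φ + (ρ : Circ), 0) = linBc ρ hv.c1 x φ + x.1.1.1 (φ, 1)
      - x.2.2.1 • dphi v (φ + (ρ : Circ)) 0 := by
    simp only [linBc, ContinuousMap.coe_mk]
    abel
  rw [hbc, hone, returnRhs_eq hf hv.c1 hV]
  abel

theorem IsAdjointField.return_map {r : Circ → ℝ → Cov n} {etaT etaρ : ℝ}
    (hr : IsAdjointField f ρ p v V r etaT etaρ) (hf : IsC1Field f)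
    (hv : IsTorusSolution f T ρ p v) (hV : IsVariationalSolution f T p v V)
    (x : Unknowns n q) (φ : Circ) :
    r φ 1 (returnRhs f T p v V (linOde hf T p hv.c1 x) (linBc ρ hv.c1 x) x.2.2.2 φ) =
      r (φ + (ρ : Circ)) 0 (x.1.1.1 (φ + (ρ : Circ), 0)) - r φ 0 (x.1.1.1 (φ, 0))
        - (etaT * x.2.1 + etaρ * x.2.2.1) := by
  rw [hr.apply_one, QPTorus.return_map hf hv hV, map_sub, map_add, map_add, hr.map_one,
    map_smul, map_smul, hr.apply_field, hr.apply_dphi, smul_eq_mul, smul_eq_mul]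
  ring

end ReturnMap

section Rotations

theorem apply_eq_apply_zero_of_periodic {G Y : Type*} [AddGroup G]
    [TopologicalSpace G] [TopologicalSpace Y] [T2Space Y] {a : G}
    (ha : DenseRange fun m : ℤ => m • a) {g : G → Y} (hg : Continuous g)
    (hper : Function.Periodic g a) (x : G) : g x = g 0 :=
  congr_fun (ha.equalizer hg continuous_const (funext fun m => by
    simpa only [Function.comp_apply, zero_add] using hper.zsmul m 0)) x

theorem integral_comp_add_right_sub_self {G F : Type*} [AddGroup G] [MeasurableSpace G]
    [MeasurableAdd G] {μ : Measure G} [μ.IsAddRightInvariant] [NormedAddCommGroup F]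
    [NormedSpace ℝ F] {g : G → F} (hg : Integrable g μ) (a : G) :
    ∫ x, (g (x + a) - g x) ∂μ = 0 := by
  rw [integral_sub (hg.comp_add_right a) hg, integral_add_right_eq_self g a, sub_self]

theorem integral_circ_const {F : Type*} [NormedAddCommGroup F] [NormedSpace ℝ F]
    [CompleteSpace F] (x : F) : ∫ _ : Circ, x = x := by
  simp [Measure.real]

theorem denseRange_zsmul_of_irrational {ρ : ℝ} (hρ : Irrational ρ) :
    DenseRange fun m : ℤ => m • (ρ : Circ) :=
  AddCircle.denseRange_zsmul_coe_iff.2 (by rwa [div_one])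

variable {c : ℝ} [hc : Fact (0 < c)]

theorem exists_pos_nsmul_mem_of_mem_nhds_zero (a : AddCircle c) {U : Set (AddCircle c)}
    (hU : U ∈ nhds 0) : ∃ k : ℕ, 0 < k ∧ k • a ∈ U := by
  obtain ⟨ε, hε, hball⟩ := Metric.mem_nhds_iff.1 hU
  obtain ⟨N, hN⟩ := exists_nat_gt (c / ε)
  have hN_pos : 0 < N := by exact_mod_cast (div_pos hc.out hε).trans hN
  obtain ⟨k, hk, hle⟩ := AddCircle.exists_norm_nsmul_le a hN_pos
  refine ⟨k, (mem_Icc.1 hk).1, hball (mem_ball_zero_iff.2 (hle.trans_lt ?_))⟩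
  rw [div_lt_comm₀ (by positivity) hε]
  exact hN.trans (by simp)

theorem fourierCoeff_comp_sub {E : Type*} [NormedAddCommGroup E] [NormedSpace ℂ E]
    (g : AddCircle c → E) (a : AddCircle c) (k : ℤ) :
    fourierCoeff (fun x => g (x - a)) k = fourier (-k) a • fourierCoeff g k := by
  rw [fourierCoeff, fourierCoeff, ← integral_smul, ← integral_sub_right_eq_self
    (fun x => fourier (-k) a • fourier (-k) x • g x) a]
  refine integral_congr_ae (.of_forall fun x => ?_)
  beta_reduce
  rw [smul_smul, fourier_apply, fourier_apply, fourier_apply, ← Circle.coe_mul,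
    ← AddCircle.toCircle_add, ← smul_add, add_sub_cancel]

theorem fourierCoeff_const {k : ℤ} (hk : k ≠ 0) (z : ℂ) :
    fourierCoeff (fun _ : AddCircle c => z) k = 0 := by
  have h := fourierCoeff.const_mul (T := c) (fun x => fourier 0 x) z k
  rw [fourierCoeff_fourier] at h
  simpa [hk] using h

theorem fourierCoeff_sub_comp_sub {g : AddCircle c → ℂ} (hg : Continuous g) (z : ℂ)
    (a : AddCircle c) {k : ℤ} (hk : k ≠ 0) :
    fourierCoeff (fun x => g x - g (x - a) + z) k =
      (1 - fourier (-k) a) * fourierCoeff g k := by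
  have hshift : Integrable ((-1 : ℂ) • fun x => g (x - a)) AddCircle.haarAddCircle :=
    integrable_of_continuous ((hg.comp (continuous_sub_right a)).const_smul (-1 : ℂ))
  have hdecomp : (fun x => g x - g (x - a) + z) =
      (g + (-1 : ℂ) • fun x => g (x - a)) + fun _ => z := by
    ext x
    simp [sub_eq_add_neg]
  rw [hdecomp, fourierCoeff.add ((integrable_of_continuous hg).add hshift) (integrable_const z),
    fourierCoeff.add (integrable_of_continuous hg) hshift, Pi.add_apply, Pi.add_apply,
    fourierCoeff.const_smul, fourierCoeff_comp_sub, fourierCoeff_const hk, smul_eq_mul,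
    smul_eq_mul]
  ring

theorem fourier_neg_coe (ρ : ℝ) (k : ℤ) :
    fourier (-k) (ρ : Circ) = Complex.exp (-(2 * Real.pi * Complex.I * k * ρ)) := by
  rw [fourier_coe_apply]
  congr 1
  push_cast
  ring

theorem small_divisor_ne_zero {ρ : ℝ} (hρ : Irrational ρ) {k : ℤ} (hk : k ≠ 0) :
    (1 : ℂ) - Complex.exp (-(2 * Real.pi * Complex.I * k * ρ)) ≠ 0 := fun h => by
  obtain ⟨m, hm⟩ := Complex.exp_eq_one_iff.1 (sub_eq_zero.1 h).symm
  have hmul : ((k : ℂ) * ρ + m) * (2 * Real.pi * Complex.I) = 0 := by linear_combination -hm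
  have hsum : (k : ℂ) * ρ + m = 0 := (mul_eq_zero.1 hmul).resolve_right Complex.two_pi_I_ne_zero
  exact ((hρ.intCast_mul hk).add_intCast m).ne_zero (by exact_mod_cast hsum)

theorem exists_small_divisor (ρ : ℝ) {ε : ℝ} (hε : 0 < ε) : ∃ k : ℤ, k ≠ 0 ∧
    ‖(1 : ℂ) - Complex.exp (-(2 * Real.pi * Complex.I * k * ρ))‖ < ε := by
  have hcont : Continuous fun x : Circ => ‖1 - fourier (-1) x‖ := by fun_prop
  obtain ⟨k, hk, hlt⟩ := exists_pos_nsmul_mem_of_mem_nhds_zero (ρ : Circ)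
    ((isOpen_lt hcont continuous_const).mem_nhds (x := 0) (by
      rwa [mem_ofPred_eq, fourier_eval_zero, sub_self, norm_zero]))
  refine ⟨k, by exact_mod_cast hk.ne', ?_⟩
  have hfourier : fourier (-(k : ℤ)) (ρ : Circ) = fourier (-1) (k • (ρ : Circ)) := by
    rw [fourier_apply, fourier_apply, neg_smul, neg_smul, one_smul, natCast_zsmul]
  rw [← fourier_neg_coe, hfourier]
  exact hlt

end Rotations

section MeanEquations

variable {n q : ℕ} {f : Vec n → Vec q → Vec n} {T ρ : ℝ} {p : Vec q} {v : Circ → ℝ → Vec n}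
  {V : Circ → ℝ → Vec n →L[ℝ] Vec n} {r : Circ → ℝ → Cov n} {etaT etaρ : ℝ}

theorem IsCotangent.continuous_apply_stripFun (hr : IsCotangent ρ V r) (w : StripFun n) :
    Continuous fun φ : Circ => r φ 0 (w.1.1 (φ, 0)) :=
  hr.continuous_zero.clm_apply ((map_continuous w.1.1).comp (Continuous.prodMk_left 0))

theorem IsCotangent.integral_apply_returnRhs (hr : IsCotangent ρ V r) (hf : IsC1Field f)
    (hv : IsC1 v) (hV : IsVariationalSolution f T p v V) (δode : C(Strip, Vec n))
    (δbc : C(Circ, Vec n)) (δp : Vec q) :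
    ∫ φ, r φ 1 (returnRhs f T p v V δode δbc δp φ) =
      (∫ φ, r φ 1 (deltaRhs V δode δbc φ)) +
        (∫ φ, (r φ 1).comp (PMat f T p v V φ 1)) δp := by
  have hP := hr.continuous_one.clm_comp (continuous_PMat_one (T := T) (p := p) hf hv hV)
  rw [ContinuousLinearMap.integral_apply (integrable_of_continuous hP), ← integral_add
    (integrable_of_continuous (hr.continuous_one.clm_apply (continuous_deltaRhs hf hv hV _ _)))
    (integrable_of_continuous (hP.clm_apply continuous_const))]
  simp only [returnRhs, map_add, ContinuousLinearMap.comp_apply]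

namespace IsAdjointField

theorem integral_returnRhs (hr : IsAdjointField f ρ p v V r etaT etaρ) (hf : IsC1Field f)
    (hv : IsTorusSolution f T ρ p v) (hV : IsVariationalSolution f T p v V)
    (x : Unknowns n q) :
    ∫ φ, r φ 1 (returnRhs f T p v V (linOde hf T p hv.c1 x) (linBc ρ hv.c1 x) x.2.2.2 φ) =
      -(etaT * x.2.1 + etaρ * x.2.2.1) := by
  have hR := integrable_of_continuous (μ := volume) (hr.continuous_apply_stripFun x.1)
  have hdiff : Integrable fun φ => r (φ + (ρ : Circ)) 0 (x.1.1.1 (φ + (ρ : Circ), 0)) -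
      r φ 0 (x.1.1.1 (φ, 0)) := (hR.comp_add_right (ρ : Circ)).sub hR
  simp only [hr.return_map hf hv hV]
  rw [integral_sub hdiff (integrable_const _), integral_comp_add_right_sub_self hR, zero_sub,
    integral_circ_const]

theorem mean_equation (hr : IsAdjointField f ρ p v V r etaT etaρ) (hf : IsC1Field f)
    (hv : IsTorusSolution f T ρ p v) (hV : IsVariationalSolution f T p v V)
    (x : Unknowns n q) :
    (∫ φ : Circ, r (φ - (ρ : Circ)) 1
        (deltaRhs V (linOde hf T p hv.c1 x) (linBc ρ hv.c1 x) (φ - (ρ : Circ))))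
      + (∫ φ : Circ, (r (φ - (ρ : Circ)) 1).comp (PMat f T p v V (φ - (ρ : Circ)) 1)) x.2.2.2
      = -(etaT * x.2.1 + etaρ * x.2.2.1) := by
  rw [integral_sub_right_eq_self (fun φ => r φ 1
      (deltaRhs V (linOde hf T p hv.c1 x) (linBc ρ hv.c1 x) φ)),
    integral_sub_right_eq_self (fun φ => (r φ 1).comp (PMat f T p v V φ 1)),
    ← hr.integral_apply_returnRhs hf hv.c1 hV, hr.integral_returnRhs hf hv hV]

theorem fourierCoeff_eq (hr : IsAdjointField f ρ p v V r etaT etaρ) (hf : IsC1Field f)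
    (hv : IsTorusSolution f T ρ p v) (hV : IsVariationalSolution f T p v V)
    (x : Unknowns n q) {k : ℤ} (hk : k ≠ 0) :
    ((1 : ℂ) - Complex.exp (-(2 * Real.pi * Complex.I * k * ρ))) *
        fourierCoeff (fun φ : Circ => ((r φ 0 (x.1.1.1 (φ, 0)) : ℝ) : ℂ)) k =
      fourierCoeff (fun φ : Circ => ((r φ 0
        (deltaRhs V (linOde hf T p hv.c1 x) (linBc ρ hv.c1 x) (φ - (ρ : Circ))
          + PMat f T p v V (φ - (ρ : Circ)) 1 x.2.2.2) : ℝ) : ℂ)) k := by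
  have hR : Continuous fun φ : Circ => ((r φ 0 (x.1.1.1 (φ, 0)) : ℝ) : ℂ) :=
    Complex.continuous_ofReal.comp (hr.continuous_apply_stripFun x.1)
  rw [← fourier_neg_coe, ← fourierCoeff_sub_comp_sub hR
    (-(etaT * x.2.1 + etaρ * x.2.2.1) : ℝ) (ρ : Circ) hk]
  congr 1
  ext φ
  have h := hr.return_map hf hv hV x (φ - (ρ : Circ))
  rw [hr.apply_sub_one, sub_add_cancel, returnRhs] at h
  rw [h]
  push_cast
  ring

end IsAdjointField

end MeanEquations

section BoundedRows

/-- Integration of a continuous function against a continuous density `g` of linear functionals,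
as a bounded linear functional for the sup-norm. -/
noncomputable def densityFunctional {X E : Type*} [TopologicalSpace X] [CompactSpace X]
    [MeasurableSpace X] [OpensMeasurableSpace X] [NormedAddCommGroup E] [NormedSpace ℝ E]
    (μ : Measure X) [IsFiniteMeasureOnCompacts μ] (g : C(X, E →L[ℝ] ℝ)) : C(X, E) →L[ℝ] ℝ :=
  LinearMap.mkContinuous
    { toFun := fun u => ∫ x, g x (u x) ∂μ
      map_add' := fun u w => by
        simp only [ContinuousMap.add_apply, map_add]
        exact integral_add
          (integrable_of_continuous ((map_continuous g).clm_apply (map_continuous u)))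
          (integrable_of_continuous ((map_continuous g).clm_apply (map_continuous w)))
      map_smul' := fun c u => by
        simp only [ContinuousMap.smul_apply, map_smul, integral_smul, RingHom.id_apply] }
    (‖g‖ * μ.real univ) fun u => by
      have hle : ∀ x, ‖g x (u x)‖ ≤ ‖g‖ * ‖u‖ := fun x =>
        (g x).le_of_opNorm_le_of_le (g.norm_coe_le_norm x) (u.norm_coe_le_norm x)
      have : IsFiniteMeasure μ := ⟨isCompact_univ.measure_lt_top⟩
      exact (norm_integral_le_of_norm_le_const (.of_forall hle)).trans_eq (mul_right_comm _ _ _)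

variable {n q : ℕ} {f : Vec n → Vec q → Vec n} {T ρ : ℝ} {p : Vec q} {v : Circ → ℝ → Vec n}
  {V : Circ → ℝ → Vec n →L[ℝ] Vec n} {r : Circ → ℝ → Cov n}

theorem IsCotangent.apply_deltaRhs (hr : IsCotangent ρ V r) (hf : IsC1Field f) (hv : IsC1 v)
    (hV : IsVariationalSolution f T p v V) (δode : C(Strip, Vec n)) (δbc : C(Circ, Vec n))
    (φ : Circ) : r φ 1 (deltaRhs V δode δbc φ) =
      (∫ τ : unitInterval, r φ τ (δode (φ, τ))) + r φ 1 (δbc φ) := by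
  have hV' := hV.isFundamental hf hv
  have hint : Continuous fun σ : unitInterval => (V φ σ).inverse (δode (φ, σ)) :=
    (continuous_inverse_apply hf hv hV δode).comp (Continuous.prodMk_right φ)
  rw [deltaRhs, map_add, hr.inv, ← (r φ 0).integral_comp_comm (integrable_of_continuous hint),
    add_comm]
  congr 2 with σ
  rw [← hr.inv φ σ, (hV'.isInvertible φ σ).self_apply_inverse]

theorem IsCotangent.integral_apply_returnRhs_eq (hr : IsCotangent ρ V r) (hf : IsC1Field f)
    (hv : IsC1 v) (hV : IsVariationalSolution f T p v V) (δode : C(Strip, Vec n))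
    (δbc : C(Circ, Vec n)) (δp : Vec q) :
    ∫ φ, r φ 1 (returnRhs f T p v V δode δbc δp φ) =
      (∫ φ : Circ, ∫ τ : unitInterval, r φ τ (δode (φ, τ))) + (∫ φ, r φ 1 (δbc φ))
        + (∫ φ, (r φ 1).comp (PMat f T p v V φ 1)) δp := by
  rw [hr.integral_apply_returnRhs hf hv hV]
  simp only [hr.apply_deltaRhs hf hv hV]
  rw [integral_add (integrable_of_continuous (continuous_integral_unitInterval
      ((continuous_restrict_strip hr.cont).clm_apply (map_continuous δode))))
    (integrable_of_continuous (hr.continuous_one.clm_apply (map_continuous δbc)))]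

theorem IsCotangent.exists_row (hr : IsCotangent ρ V r) (hf : IsC1Field f) (hv : IsC1 v)
    (hV : IsVariationalSolution f T p v V) :
    ∃ R : Violations n × Vec q →L[ℝ] ℝ, ∀ y,
      R y = -∫ φ, r φ 1 (returnRhs f T p v V y.1.1 y.1.2.1 y.2 φ) := by
  let rStrip : C(Strip, Cov n) := ⟨_, continuous_restrict_strip hr.cont⟩
  let rOne : C(Circ, Cov n) := ⟨_, hr.continuous_one⟩
  refine ⟨-((densityFunctional volume rStrip).comp (.comp (.fst ℝ _ _) (.fst ℝ _ _))
    + (densityFunctional volume rOne).comp (.comp (.fst ℝ _ _) (.comp (.snd ℝ _ _) (.fst ℝ _ _)))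
    + (∫ φ, (r φ 1).comp (PMat f T p v V φ 1)).comp (.snd ℝ _ _)), fun y => ?_⟩
  rw [hr.integral_apply_returnRhs_eq hf hv hV, integral_strip (fun z => r z.1 z.2 (y.1.1 z))
    ((continuous_restrict_strip hr.cont).clm_apply (map_continuous y.1.1))]
  rfl

end BoundedRows

section Transversal

variable {n q : ℕ} {f : Vec n → Vec q → Vec n} {T ρ : ℝ} {p : Vec q} {v : Circ → ℝ → Vec n}
  {V : Circ → ℝ → Vec n →L[ℝ] Vec n} {qτ qφ : Circ → ℝ → Cov n}

theorem qtr_apply (φ : Circ) (τ : ℝ) (x : Vec n) :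
    qtr v qτ qφ φ τ x = x - (qτ φ τ x • dtau v φ τ + qφ φ τ x • dphi v φ τ) := rfl

theorem IsVariationalSolution.Gam_zero (hV : IsVariationalSolution f T p v V) (w : Circ → Vec n)
    (φ : Circ) : Gam ρ V 0 w φ = V (φ - (ρ : Circ)) 1 (w (φ - (ρ : Circ))) - w φ := by
  simp [Gam, hV.init]

namespace IsNormallyHyperbolic

theorem cotangent_qtr (hq : IsNormallyHyperbolic ρ v V qτ qφ) (φ : Circ) (τ : ℝ) (x : Vec n) :
    qτ φ τ (qtr v qτ qφ φ τ x) = 0 ∧ qφ φ τ (qtr v qτ qφ φ τ x) = 0 := by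
  rw [qtr_apply, map_sub, map_sub, hq.qτ_tangent, hq.qφ_tangent, sub_self, sub_self]
  exact ⟨rfl, rfl⟩

theorem continuous_qtr_apply (hq : IsNormallyHyperbolic ρ v V qτ qφ) (hf : IsC1Field f)
    (hv : IsTorusSolution f T ρ p v) {m : Circ → Vec n} (hm : Continuous m) :
    Continuous fun φ => qtr v qτ qφ φ 0 (m φ) := by
  have hslice : Continuous fun φ : Circ => (φ, (0 : ℝ)) := Continuous.prodMk_left 0
  exact hm.sub ((((hq.cont_qτ.comp hslice).clm_apply hm).smul
    (hv.isTangent_dtau hf).continuous_zero).add (((hq.cont_qφ.comp hslice).clm_apply hm).smul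
    (hv.isTangent_dphi hf).continuous_zero))

theorem isTransversal_iff (hq : IsNormallyHyperbolic ρ v V qτ qφ) {τ : ℝ} {w : C(Circ, Vec n)} :
    IsTransversal v qτ qφ τ w ↔ ∀ φ, qτ φ τ (w φ) = 0 ∧ qφ φ τ (w φ) = 0 := by
  refine ⟨fun ⟨δ, hδ⟩ φ => ?_, fun h => ⟨w, fun φ => ?_⟩⟩
  · rw [hδ]
    exact hq.cotangent_qtr φ τ (δ φ)
  · rw [qtr_apply, (h φ).1, (h φ).2, zero_smul, zero_smul, add_zero, sub_zero]

theorem eq_zero_of_map_eq (hq : IsNormallyHyperbolic ρ v V qτ qφ)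
    (hV : IsVariationalSolution f T p v V) {w : C(Circ, Vec n)}
    (hw : IsTransversal v qτ qφ 0 w) (h : ∀ φ, w (φ + (ρ : Circ)) = V φ 1 (w φ)) : w = 0 := by
  have h_zero : IsTransversal v qτ qφ 0 0 := hq.isTransversal_iff.2 fun φ => by simp
  obtain ⟨C, hC⟩ := hq.bijective 0
  obtain ⟨w₀, -, -, -, hunique⟩ := hC 0 h_zero
  rw [hunique 0 h_zero fun φ => by simp [hV.Gam_zero]]
  exact hunique w hw fun φ => by simp [hV.Gam_zero, ← h]

theorem exists_map_sub_eq (hq : IsNormallyHyperbolic ρ v V qτ qφ)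
    (hV : IsVariationalSolution f T p v V) {g : C(Circ, Vec n)}
    (hg : IsTransversal v qτ qφ 0 g) :
    ∃ w : C(Circ, Vec n), ∀ φ, V φ 1 (w φ) - w (φ + (ρ : Circ)) = g (φ + (ρ : Circ)) := by
  obtain ⟨C, hC⟩ := hq.bijective 0
  obtain ⟨w, -, hw, -, -⟩ := hC g hg
  exact ⟨w, fun φ => by simpa [hV.Gam_zero] using hw (φ + (ρ : Circ))⟩

end IsNormallyHyperbolic

/-- The tangent field `c₀ ∂_τ v + c₁ ∂_φ v`, that is, the infinitesimal shift of `v` along the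
torus in the direction `c`. -/
noncomputable def tangentField (v : Circ → ℝ → Vec n) (c : Fin 2 → ℝ) (φ : Circ) (τ : ℝ) : Vec n :=
  c 0 • dtau v φ τ + c 1 • dphi v φ τ

theorem IsTorusSolution.isTangent_tangentField (hv : IsTorusSolution f T ρ p v)
    (hf : IsC1Field f) (c : Fin 2 → ℝ) : IsTangent ρ (coeff f T p v) (tangentField v c) :=
  ((hv.isTangent_dtau hf).const_smul (c 0)).add ((hv.isTangent_dphi hf).const_smul (c 1))

/-- The nondegeneracy matrix of the phase conditions: their response to infinitesimal shifts
along the torus. -/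
noncomputable def phaseMatrix (v : Circ → ℝ → Vec n) (K : Fin 2 → C(Strip, Cov n)) :
    Matrix (Fin 2) (Fin 2) ℝ :=
  Matrix.of fun i : Fin 2 =>
    ![∫ φ : Circ, ∫ τ : unitInterval, K i (φ, τ) (dtau v φ τ),
      ∫ φ : Circ, ∫ τ : unitInterval, K i (φ, τ) (dphi v φ τ)]

theorem integral_tangentField (hf : IsC1Field f) (hv : IsTorusSolution f T ρ p v)
    (K : Fin 2 → C(Strip, Cov n)) (c : Fin 2 → ℝ) (i : Fin 2) :
    ∫ φ : Circ, ∫ τ : unitInterval, K i (φ, τ) (tangentField v c φ τ) =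
      (phaseMatrix v K).mulVec c i := by
  have hK : ∀ {e : Circ → ℝ → Vec n}, IsTangent ρ (coeff f T p v) e →
      Continuous fun z : Strip => K i z (e z.1 z.2) := fun he =>
    (map_continuous (K i)).clm_apply (continuous_restrict_strip he.cont)
  have hτ := hK (hv.isTangent_dtau hf)
  have hφ := hK (hv.isTangent_dphi hf)
  have hc := hK (hv.isTangent_tangentField hf c)
  have hsum : ∫ z : Strip, K i z (tangentField v c z.1 z.2) =
      c 0 * (∫ z : Strip, K i z (dtau v z.1 z.2)) + c 1 * ∫ z : Strip, K i z (dphi v z.1 z.2) := by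
    rw [← integral_const_mul, ← integral_const_mul, ← integral_add
      ((integrable_of_continuous hτ).const_mul _) ((integrable_of_continuous hφ).const_mul _)]
    simp only [tangentField, map_add, map_smul, smul_eq_mul]
  rw [integral_strip _ hc, hsum, ← integral_strip _ hτ, ← integral_strip _ hφ]
  simp only [phaseMatrix, Matrix.mulVec, dotProduct, Fin.sum_univ_two, Matrix.of_apply,
    Matrix.cons_val_zero, Matrix.cons_val_one]
  ring

-- The components along `∂_τ v` and `∂_φ v` are invariant under the irrational rotation, hence
-- constant; the transversal remainder vanishes because `Γ_{ρ,0}` is injective.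
theorem IsNormallyHyperbolic.exists_eq_tangentField (hq : IsNormallyHyperbolic ρ v V qτ qφ)
    (hρ : Irrational ρ) (hf : IsC1Field f) (hv : IsTorusSolution f T ρ p v)
    (hV : IsVariationalSolution f T p v V) {u : Circ → Vec n} (hu : Continuous u)
    (hmap : ∀ φ, u (φ + (ρ : Circ)) = V φ 1 (u φ)) : ∃ c, ∀ φ, u φ = tangentField v c φ 0 := by
  have hconst : ∀ {r : Circ → ℝ → Cov n}, IsCotangent ρ V r → ∀ φ, r φ 0 (u φ) = r 0 0 (u 0) :=
    fun {r} hr => apply_eq_apply_zero_of_periodic (g := fun φ => r φ 0 (u φ))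
      (denseRange_zsmul_of_irrational hρ) (hr.continuous_zero.clm_apply hu)
      fun φ => by simp only [hmap, hr.map_one]
  set c : Fin 2 → ℝ := ![qτ 0 0 (u 0), qφ 0 0 (u 0)]
  have he := hv.isTangent_tangentField hf c
  let w : C(Circ, Vec n) := ⟨fun φ => u φ - tangentField v c φ 0, hu.sub he.continuous_zero⟩
  have hw : w = 0 := by
    refine hq.eq_zero_of_map_eq hV (hq.isTransversal_iff.2 fun φ => ?_) fun φ => ?_
    · change qτ φ 0 (u φ - tangentField v c φ 0) = 0 ∧ qφ φ 0 (u φ - tangentField v c φ 0) = 0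
      rw [map_sub, map_sub, tangentField, hq.qτ_tangent, hq.qφ_tangent,
        hconst (hq.isAdjointField_qτ hf hv hV).toIsCotangent,
        hconst (hq.isAdjointField_qφ hf hv hV).toIsCotangent]
      exact ⟨sub_self _, sub_self _⟩
    · change u _ - tangentField v c _ 0 = V φ 1 (u φ - tangentField v c φ 0)
      rw [map_sub, he.map_one (hV.isFundamental hf hv.c1), hmap]
  exact ⟨c, fun φ => sub_eq_zero.1 (DFunLike.congr_fun hw φ)⟩

theorem IsNormallyHyperbolic.exists_stripFun_eq_tangentField
    (hq : IsNormallyHyperbolic ρ v V qτ qφ) (hρ : Irrational ρ) (hf : IsC1Field f)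
    (hv : IsTorusSolution f T ρ p v) (hV : IsVariationalSolution f T p v V) {w : StripFun n}
    (hode : ∀ z : Strip, w.1.2 z = coeff f T p v z.1 z.2 (w.1.1 z))
    (hbc : ∀ φ : Circ, w.1.1 (φ + (ρ : Circ), 0) = w.1.1 (φ, 1)) :
    ∃ c, ∀ (φ : Circ) (τ : unitInterval), w.1.1 (φ, τ) = tangentField v c φ τ := by
  have hV' := hV.isFundamental hf hv.c1
  obtain ⟨c, hc⟩ := hq.exists_eq_tangentField hρ hf hv hV (u := fun φ => w.1.1 (φ, 0))
    ((map_continuous w.1.1).comp (Continuous.prodMk_left 0))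
    fun φ => by simpa only [Icc.coe_one] using (hbc φ).trans (hV'.stripFun_eq_map hode φ 1)
  exact ⟨c, fun φ τ => by
    rw [hV'.stripFun_eq_map hode, hc φ, (hv.isTangent_tangentField hf c).map_eq hV']⟩

theorem linPs_eq_mulVec (hf : IsC1Field f) (hv : IsTorusSolution f T ρ p v)
    (K : Fin 2 → C(Strip, Cov n)) (H : Fin 2 → Cov q) {x : Unknowns n q} {c : Fin 2 → ℝ}
    (hx : ∀ (φ : Circ) (τ : unitInterval), x.1.1.1 (φ, τ) = tangentField v c φ τ)
    (hp : x.2.2.2 = 0) : linPs K H x = WithLp.toLp 2 ((phaseMatrix v K).mulVec c) := by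
  ext i
  simp only [linPs, hx, hp, map_zero, add_zero, integral_tangentField hf hv]

theorem returnRhs_zero (φ : Circ) : returnRhs f T p v V 0 0 0 φ = 0 := by
  simp [returnRhs, deltaRhs]

theorem IsAdjointField.eq_zero_of_linReduced_eq_zero {r : Circ → ℝ → Cov n} {etaT etaρ : ℝ}
    (hr : IsAdjointField f ρ p v V r etaT etaρ) (hf : IsC1Field f)
    (hv : IsTorusSolution f T ρ p v) (hV : IsVariationalSolution f T p v V)
    {K : Fin 2 → C(Strip, Cov n)} {H : Fin 2 → Cov q} {x : Unknowns n q}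
    (hx : linReduced hf T ρ p hv.c1 K H x = 0) : etaT * x.2.1 + etaρ * x.2.2.1 = 0 := by
  have hode : linOde hf T p hv.c1 x = 0 := congr_arg (fun y => y.1.1) hx
  have hbc : linBc ρ hv.c1 x = 0 := congr_arg (fun y => y.1.2.1) hx
  have hp : x.2.2.2 = 0 := congr_arg (fun y => y.2) hx
  have h := hr.integral_returnRhs hf hv hV x
  rw [hode, hbc, hp] at h
  simpa only [returnRhs_zero, map_zero, integral_zero, zero_eq_neg] using h

theorem IsNormallyHyperbolic.linReduced_injective (hq : IsNormallyHyperbolic ρ v V qτ qφ)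
    (hρ : Irrational ρ) (hf : IsC1Field f) (hv : IsTorusSolution f T ρ p v)
    (hV : IsVariationalSolution f T p v V) {K : Fin 2 → C(Strip, Cov n)}
    (hK : (phaseMatrix v K).det ≠ 0) (H : Fin 2 → Cov q) :
    Function.Injective (linReduced hf T ρ p hv.c1 K H) := by
  rw [injective_iff_map_eq_zero]
  intro x hx
  have hode : linOde hf T p hv.c1 x = 0 := congr_arg (fun y => y.1.1) hx
  have hbc : linBc ρ hv.c1 x = 0 := congr_arg (fun y => y.1.2.1) hx
  have hps : linPs K H x = 0 := congr_arg (fun y => y.1.2.2) hx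
  have hp : x.2.2.2 = 0 := congr_arg (fun y => y.2) hx
  have hT : x.2.1 = 0 := by
    simpa [hq.T_ne_zero hv] using
      (hq.isAdjointField_qτ hf hv hV).eq_zero_of_linReduced_eq_zero hf hv hV hx
  have hδρ : x.2.2.1 = 0 := by
    simpa using (hq.isAdjointField_qφ hf hv hV).eq_zero_of_linReduced_eq_zero hf hv hV hx
  have hder : ∀ z : Strip, x.1.1.2 z = coeff f T p v z.1 z.2 (x.1.1.1 z) := fun z =>
    sub_eq_zero.1 (by
      simpa [hode, hp, hT] using snd_sub_coeff_apply (T := T) (p := p) hf hv.c1 x z)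
  have hbc' : ∀ φ : Circ, x.1.1.1 (φ + (ρ : Circ), 0) = x.1.1.1 (φ, 1) := fun φ => by
    simpa [linBc, hδρ, sub_eq_zero] using DFunLike.congr_fun hbc φ
  obtain ⟨c, hsol⟩ := hq.exists_stripFun_eq_tangentField hρ hf hv hV hder hbc'
  have hc_zero : c = 0 := Matrix.eq_zero_of_mulVec_eq_zero hK <| (WithLp.toLp_injective 2) <| by
    rw [← linPs_eq_mulVec hf hv K H hsol hp, hps, WithLp.toLp_zero]
  have hfst : x.1.1.1 = 0 := by
    ext1 z
    simpa [hc_zero, tangentField] using hsol z.1 z.2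
  have hsnd : x.1.1.2 = 0 := by
    ext1 z
    simpa [hfst] using hder z
  exact Prod.ext (Subtype.ext (Prod.ext hfst hsnd)) (Prod.ext hT (Prod.ext hδρ hp))

end Transversal

section Adjoint

variable {n q : ℕ} {f : Vec n → Vec q → Vec n} {T ρ : ℝ} {p : Vec q} {v : Circ → ℝ → Vec n}
  {V : Circ → ℝ → Vec n →L[ℝ] Vec n} {qτ qφ : Circ → ℝ → Cov n} {K : Fin 2 → C(Strip, Cov n)}
  {H : Fin 2 → Cov q} {ldE : Circ → ℝ → Cov n} {lbc : C(Circ, Cov n)} {lps : Fin 2 → ℝ}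
  {etaT etaρ : ℝ} {etap : Cov q} {r : Circ → ℝ → Cov n}

theorem IsCotangent.comp_PMat (hr : IsCotangent ρ V r) (hf : IsC1Field f) (hv : IsC1 v)
    (hV : IsVariationalSolution f T p v V) (φ : Circ) :
    (r φ 1).comp (PMat f T p v V φ 1) =
      ∫ σ in (0 : ℝ)..1, T • (r φ σ).comp (dp f (v φ σ) p) := by
  have hV' := hV.isFundamental hf hv
  have hint : Continuous fun σ : unitInterval => (V φ σ).inverse.comp (dp f (v φ σ) p) :=
    (continuous_inverse_comp_dp hf hv hV).comp (Continuous.prodMk_right φ)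
  have hcomp : (r φ 1).comp (V φ 1) = r φ 0 := ContinuousLinearMap.ext (hr.inv φ 1)
  rw [PMat_one, ContinuousLinearMap.comp_smul, ← ContinuousLinearMap.comp_assoc, hcomp,
    intervalIntegral.integral_smul,
    ← integral_unitInterval fun σ => (r φ σ).comp (dp f (v φ σ) p)]
  refine congr_arg (T • ·) ?_
  refine (((ContinuousLinearMap.compL ℝ (Vec q) (Vec n) ℝ (r φ 0)).integral_comp_comm
    (integrable_of_continuous hint)).symm).trans (integral_congr_ae (.of_forall fun σ => ?_))
  ext x
  change r φ 0 ((V φ σ).inverse (dp f (v φ σ) p x)) = r φ σ (dp f (v φ σ) p x)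
  rw [← hr.inv φ σ, (hV'.isInvertible φ σ).self_apply_inverse]

theorem IsCotangent.integral_comp_dp_eq (hr : IsCotangent ρ V r) (hf : IsC1Field f)
    (hv : IsC1 v) (hV : IsVariationalSolution f T p v V)
    (hde : ∀ φ, ∀ τ ∈ Icc (0 : ℝ) 1, ldE φ τ = r φ τ) :
    ∫ φ : Circ, ∫ τ in (0 : ℝ)..1, T • (ldE φ τ).comp (dp f (v φ τ) p) =
      ∫ φ : Circ, (r φ 1).comp (PMat f T p v V φ 1) := by
  refine integral_congr_ae (.of_forall fun φ => ?_)
  simp only [hr.comp_PMat hf hv hV]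
  refine intervalIntegral.integral_congr fun τ hτ => ?_
  simp only [hde φ τ (by rwa [uIcc_of_le zero_le_one] at hτ)]

theorem IsAdjointField.isAdjointSolution (hr : IsAdjointField f ρ p v V r etaT etaρ)
    (hf : IsC1Field f) (hv : IsC1 v) (hV : IsVariationalSolution f T p v V)
    (hde : ∀ φ, ∀ τ ∈ Icc (0 : ℝ) 1, ldE φ τ = r φ τ) (hbc : ∀ φ, lbc φ = r φ 1) :
    IsAdjointSolution f T ρ p v K H ldE lbc 0 etaT etaρ
      (∫ φ : Circ, (r φ 1).comp (PMat f T p v V φ 1)) where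
  var_v φ τ := by
    refine (((hr.hasDerivAt (hV.isFundamental hf hv) φ τ).hasDerivWithinAt).congr (hde φ)
      (hde φ τ τ.2)).congr_deriv ?_
    simp [hde φ τ τ.2, coeff]
  var_v1 φ := by rw [hde φ 1 (right_mem_Icc.2 zero_le_one), hbc, sub_self]
  var_v0 φ := by
    rw [hde φ 0 (left_mem_Icc.2 zero_le_one), hbc, hr.apply_sub_one, neg_add_cancel]
  var_T := by
    have hconst : ∀ φ, ∫ τ in (0 : ℝ)..1, ldE φ τ (f (v φ τ) p) = etaT := fun φ => by
      rw [intervalIntegral.integral_congr (g := fun _ => etaT) fun τ hτ => by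
        rw [hde φ τ (by rwa [uIcc_of_le zero_le_one] at hτ), hr.apply_field]]
      simp
    simp only [hconst, integral_circ_const, neg_add_cancel]
  var_ρ := by
    simp only [hbc, hr.apply_one, hr.apply_dphi, integral_circ_const,
      neg_add_cancel]
  var_p := by
    rw [hr.integral_comp_dp_eq hf hv hV hde]
    simp

namespace IsAdjointSolution

theorem apply_one (h : IsAdjointSolution f T ρ p v K H ldE lbc lps etaT etaρ etap) (φ : Circ) :
    ldE φ 1 = lbc φ :=
  sub_eq_zero.1 (h.var_v1 φ).symm

theorem apply_zero (h : IsAdjointSolution f T ρ p v K H ldE lbc lps etaT etaρ etap) (φ : Circ) :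
    ldE φ 0 = lbc (φ - (ρ : Circ)) :=
  neg_add_eq_zero.1 (h.var_v0 φ).symm

theorem apply_add_zero (h : IsAdjointSolution f T ρ p v K H ldE lbc lps etaT etaρ etap)
    (φ : Circ) : ldE (φ + (ρ : Circ)) 0 = ldE φ 1 := by
  rw [h.apply_zero, h.apply_one, add_sub_cancel_right]

theorem continuous_zero (h : IsAdjointSolution f T ρ p v K H ldE lbc lps etaT etaρ etap) :
    Continuous fun φ => ldE φ 0 := by
  simp only [h.apply_zero]
  fun_prop

theorem hasDerivWithinAt_apply
    (h : IsAdjointSolution f T ρ p v K H ldE lbc lps etaT etaρ etap) (φ : Circ)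
    (τ : unitInterval) {e : ℝ → Vec n} (he : HasDerivAt e (coeff f T p v φ τ (e τ)) τ) :
    HasDerivWithinAt (fun s => ldE φ s (e s)) (∑ i, lps i * K i (φ, τ) (e τ)) (Icc 0 1) τ :=
  ((h.var_v φ τ).clm_apply he.hasDerivWithinAt).congr_deriv (by simp [coeff])

theorem apply_one_sub_apply_zero
    (h : IsAdjointSolution f T ρ p v K H ldE lbc lps etaT etaρ etap) (φ : Circ) {e : ℝ → Vec n}
    (he : ∀ s, HasDerivAt e (coeff f T p v φ s (e s)) s) :
    ldE φ 1 (e 1) - ldE φ 0 (e 0) = ∫ τ : unitInterval, ∑ i, lps i * K i (φ, τ) (e τ) := by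
  have he_cont : Continuous e := continuous_iff_continuousAt.2 fun s => (he s).continuousAt
  let g : ℝ → ℝ := fun s => ∑ i, lps i * K i (φ, projIcc 0 1 zero_le_one s) (e s)
  have hg : Continuous g := by
    refine continuous_finsetSum _ fun i _ => continuous_const.mul (Continuous.clm_apply ?_ he_cont)
    exact (map_continuous (K i)).comp (continuous_const.prodMk continuous_projIcc)
  have hint := intervalIntegral_eq_sub_of_hasDerivWithinAt (w := fun s => ldE φ s (e s))
    zero_le_one hg.continuousOn fun s hs => by
      simpa only [g, projIcc_of_mem zero_le_one hs] using
        h.hasDerivWithinAt_apply φ ⟨s, hs⟩ (he s)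
  rw [← hint, ← integral_unitInterval]
  simp only [g, projIcc_val]

theorem sum_mul_integral_tangent
    (h : IsAdjointSolution f T ρ p v K H ldE lbc lps etaT etaρ etap) {e : Circ → ℝ → Vec n}
    (he : IsTangent ρ (coeff f T p v) e) :
    ∑ i, lps i * ∫ φ : Circ, ∫ τ : unitInterval, K i (φ, τ) (e φ τ) = 0 := by
  have hK : ∀ i, Continuous fun z : Strip => K i z (e z.1 z.2) := fun i =>
    (map_continuous (K i)).clm_apply (continuous_restrict_strip he.cont)
  have hpair : Integrable fun φ => ldE φ 0 (e φ 0) :=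
    integrable_of_continuous (h.continuous_zero.clm_apply he.continuous_zero)
  calc ∑ i, lps i * ∫ φ : Circ, ∫ τ : unitInterval, K i (φ, τ) (e φ τ)
      = ∫ φ : Circ, ∫ τ : unitInterval, ∑ i, lps i * K i (φ, τ) (e φ τ) := by
        rw [integral_strip (fun z => ∑ i, lps i * K i z (e z.1 z.2))
          (continuous_finsetSum _ fun i _ => (hK i).const_mul _), integral_finsetSum _
          fun i _ => (integrable_of_continuous (hK i)).const_mul _]
        simp only [integral_const_mul, ← integral_strip _ (hK _)]
    _ = ∫ φ : Circ, (ldE (φ + (ρ : Circ)) 0 (e (φ + (ρ : Circ)) 0) - ldE φ 0 (e φ 0)) := by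
        simp only [← h.apply_one_sub_apply_zero _ (he.ode _), h.apply_add_zero, ← he.shift,
          zero_add]
    _ = 0 := integral_comp_add_right_sub_self hpair (ρ : Circ)

theorem lps_eq_zero (h : IsAdjointSolution f T ρ p v K H ldE lbc lps etaT etaρ etap)
    (hf : IsC1Field f) (hv : IsTorusSolution f T ρ p v) (hK : (phaseMatrix v K).det ≠ 0) :
    lps = 0 := by
  refine Matrix.eq_zero_of_vecMul_eq_zero hK (funext fun j => ?_)
  fin_cases j
  · exact h.sum_mul_integral_tangent (hv.isTangent_dtau hf)
  · exact h.sum_mul_integral_tangent (hv.isTangent_dphi hf)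

theorem apply_eq_apply_zero (h : IsAdjointSolution f T ρ p v K H ldE lbc 0 etaT etaρ etap)
    {φ : Circ} {e : ℝ → Vec n} (he : ∀ s, HasDerivAt e (coeff f T p v φ s (e s)) s) {τ : ℝ}
    (hτ : τ ∈ Icc (0 : ℝ) 1) : ldE φ τ (e τ) = ldE φ 0 (e 0) := by
  have hsub := intervalIntegral_eq_sub_of_hasDerivWithinAt (g := fun _ => 0)
    (w := fun s => ldE φ s (e s)) hτ.1 continuousOn_const fun s hs =>
      ((h.hasDerivWithinAt_apply φ ⟨s, hs.1, hs.2.trans hτ.2⟩ (he s)).mono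
        (Icc_subset_Icc_right hτ.2)).congr_deriv (by simp)
  exact sub_eq_zero.1 (hsub.symm.trans intervalIntegral.integral_zero)

theorem apply_fundamental (h : IsAdjointSolution f T ρ p v K H ldE lbc 0 etaT etaρ etap)
    (hV : IsFundamental (coeff f T p v) V) (φ : Circ) {τ : ℝ} (hτ : τ ∈ Icc (0 : ℝ) 1)
    (x : Vec n) : ldE φ τ (V φ τ x) = ldE φ 0 x := by
  simpa [hV.init] using h.apply_eq_apply_zero (fun s => hV.hasDerivAt_apply φ s x) hτ

theorem apply_tangent (h : IsAdjointSolution f T ρ p v K H ldE lbc 0 etaT etaρ etap)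
    (hρ : Irrational ρ) {e : Circ → ℝ → Vec n} (he : IsTangent ρ (coeff f T p v) e) (φ : Circ)
    {τ : ℝ} (hτ : τ ∈ Icc (0 : ℝ) 1) : ldE φ τ (e φ τ) = ldE 0 0 (e 0 0) := by
  rw [h.apply_eq_apply_zero (he.ode φ) hτ]
  refine apply_eq_apply_zero_of_periodic (g := fun φ => ldE φ 0 (e φ 0))
    (denseRange_zsmul_of_irrational hρ) (h.continuous_zero.clm_apply he.continuous_zero)
    (fun φ => ?_) φ
  simp only [h.apply_add_zero, ← he.shift, zero_add,
    h.apply_eq_apply_zero (he.ode φ) (right_mem_Icc.2 zero_le_one)]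

theorem apply_field (h : IsAdjointSolution f T ρ p v K H ldE lbc 0 etaT etaρ etap)
    (hρ : Irrational ρ) (hf : IsC1Field f) (hv : IsTorusSolution f T ρ p v) (φ : Circ) :
    ldE φ 0 (f (v φ 0) p) = etaT := by
  have he := hv.isTangent_field hf
  have hconst : ∀ φ, ∫ τ in (0 : ℝ)..1, ldE φ τ (f (v φ τ) p) = ldE 0 0 (f (v 0 0) p) :=
    fun φ => by
      rw [intervalIntegral.integral_congr (g := fun _ => ldE 0 0 (f (v 0 0) p)) fun τ hτ =>
        h.apply_tangent hρ he φ (by rwa [uIcc_of_le zero_le_one] at hτ)]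
      simp
  have hT := h.var_T
  simp only [hconst, integral_circ_const] at hT
  rw [h.apply_tangent hρ he φ (left_mem_Icc.2 zero_le_one)]
  exact neg_add_eq_zero.1 hT.symm

theorem apply_dphi (h : IsAdjointSolution f T ρ p v K H ldE lbc 0 etaT etaρ etap)
    (hρ : Irrational ρ) (hf : IsC1Field f) (hv : IsTorusSolution f T ρ p v) (φ : Circ) :
    ldE φ 0 (dphi v φ 0) = -etaρ := by
  have he := hv.isTangent_dphi hf
  have hconst : ∀ φ, lbc φ (dphi v (φ + (ρ : Circ)) 0) = ldE 0 0 (dphi v 0 0) := fun φ => by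
    rw [← h.apply_one, ← he.shift, zero_add,
      h.apply_tangent hρ he φ (right_mem_Icc.2 zero_le_one)]
  have hρ' := h.var_ρ
  simp only [hconst, integral_circ_const] at hρ'
  rw [h.apply_tangent hρ he φ (left_mem_Icc.2 zero_le_one)]
  exact eq_neg_of_add_eq_zero_left hρ'.symm

end IsAdjointSolution

namespace IsNormallyHyperbolic

theorem integral_apply_transversal_eq_zero (hq : IsNormallyHyperbolic ρ v V qτ qφ)
    (hV : IsVariationalSolution f T p v V) {c : Circ → Cov n} (hc : Continuous c)
    (hinv : ∀ φ x, c (φ + (ρ : Circ)) (V φ 1 x) = c φ x) {g : C(Circ, Vec n)}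
    (hg : IsTransversal v qτ qφ 0 g) : ∫ φ, c φ (g φ) = 0 := by
  obtain ⟨w, hw⟩ := hq.exists_map_sub_eq hV hg
  have hcw : Integrable fun φ => c φ (w φ) :=
    integrable_of_continuous (hc.clm_apply (map_continuous w))
  calc ∫ φ, c φ (g φ) = ∫ φ, c (φ + (ρ : Circ)) (g (φ + (ρ : Circ))) :=
        (integral_add_right_eq_self (fun φ => c φ (g φ)) (ρ : Circ)).symm
    _ = ∫ φ, -(c (φ + (ρ : Circ)) (w (φ + (ρ : Circ))) - c φ (w φ)) := by
        simp only [← hw, map_sub, hinv, neg_sub]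
    _ = 0 := by rw [integral_neg, integral_comp_add_right_sub_self hcw, neg_zero]

-- On the transversal part `y φ` of a fixed vector `x`, test with the transversal field
-- `c(y) y`: the integral of `c(y)²` vanishes.
theorem apply_qtr_eq_zero (hq : IsNormallyHyperbolic ρ v V qτ qφ) (hf : IsC1Field f)
    (hv : IsTorusSolution f T ρ p v) (hV : IsVariationalSolution f T p v V) {c : Circ → Cov n}
    (hc : Continuous c) (hinv : ∀ φ x, c (φ + (ρ : Circ)) (V φ 1 x) = c φ x) (φ : Circ)
    (x : Vec n) : c φ (qtr v qτ qφ φ 0 x) = 0 := by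
  have hy : Continuous fun φ => qtr v qτ qφ φ 0 x := hq.continuous_qtr_apply hf hv continuous_const
  have hcy : Continuous fun φ => c φ (qtr v qτ qφ φ 0 x) := hc.clm_apply hy
  let g : C(Circ, Vec n) := ⟨fun φ => c φ (qtr v qτ qφ φ 0 x) • qtr v qτ qφ φ 0 x, hcy.smul hy⟩
  have hg : IsTransversal v qτ qφ 0 g := hq.isTransversal_iff.2 fun φ => by
    simp [g, hq.cotangent_qtr]
  have hint : ∫ φ, c φ (qtr v qτ qφ φ 0 x) ^ 2 = 0 := by
    simpa [g, sq] using hq.integral_apply_transversal_eq_zero hV hc hinv hg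
  have hae := (integral_eq_zero_iff_of_nonneg (fun φ => sq_nonneg (c φ (qtr v qτ qφ φ 0 x)))
    (integrable_of_continuous (hcy.pow 2))).1 hint
  exact pow_eq_zero_iff two_ne_zero |>.1
    (congr_fun ((hcy.pow 2).ae_eq_iff_eq volume continuous_zero |>.1 hae) φ)

theorem eq_zero_of_apply_tangent_eq_zero (hq : IsNormallyHyperbolic ρ v V qτ qφ)
    (hf : IsC1Field f) (hv : IsTorusSolution f T ρ p v) (hV : IsVariationalSolution f T p v V)
    {c : Circ → Cov n} (hc : Continuous c) (hinv : ∀ φ x, c (φ + (ρ : Circ)) (V φ 1 x) = c φ x)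
    (hτ : ∀ φ, c φ (dtau v φ 0) = 0) (hφ : ∀ φ, c φ (dphi v φ 0) = 0) : c = 0 := by
  ext φ x
  simpa [qtr_apply, hτ, hφ] using hq.apply_qtr_eq_zero hf hv hV hc hinv φ x

theorem isAdjointSolution_iff (hq : IsNormallyHyperbolic ρ v V qτ qφ) (hρ : Irrational ρ)
    (hf : IsC1Field f) (hv : IsTorusSolution f T ρ p v) (hV : IsVariationalSolution f T p v V)
    (hK : (phaseMatrix v K).det ≠ 0) (hr : IsAdjointField f ρ p v V r etaT etaρ) :
    IsAdjointSolution f T ρ p v K H ldE lbc lps etaT etaρ etap ↔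
      (∀ φ, ∀ τ ∈ Icc (0 : ℝ) 1, ldE φ τ = r φ τ) ∧ (∀ φ, lbc φ = r φ 1) ∧ lps = 0 ∧
        etap = ∫ φ : Circ, (r φ 1).comp (PMat f T p v V φ 1) := by
  refine ⟨fun h => ?_, fun ⟨hde, hbc, hps, hp⟩ => ?_⟩
  · obtain rfl := h.lps_eq_zero hf hv hK
    have hV' := hV.isFundamental hf hv.c1
    have hzero : (fun φ => ldE φ 0 - r φ 0) = 0 :=
      hq.eq_zero_of_apply_tangent_eq_zero hf hv hV (h.continuous_zero.sub hr.continuous_zero)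
        (fun φ x => by
          rw [sub_apply, sub_apply, h.apply_add_zero, hr.map_one,
            h.apply_fundamental hV' φ (right_mem_Icc.2 zero_le_one)])
        (fun φ => by
          rw [sub_apply, hv.dtau_eq, map_smul, map_smul, h.apply_field hρ hf hv, hr.apply_field,
            sub_self])
        (fun φ => by rw [sub_apply, h.apply_dphi hρ hf hv, hr.apply_dphi, sub_self])
    have hde : ∀ φ, ∀ τ ∈ Icc (0 : ℝ) 1, ldE φ τ = r φ τ := fun φ τ hτ => by
      ext x
      rw [← (hV'.isInvertible φ τ).self_apply_inverse x, h.apply_fundamental hV' φ hτ, hr.inv,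
        sub_eq_zero.1 (congr_fun hzero φ)]
    refine ⟨hde, fun φ => ?_, rfl, ?_⟩
    · rw [← h.apply_one, hde φ 1 (right_mem_Icc.2 zero_le_one)]
    · have hp := h.var_p
      rw [hr.integral_comp_dp_eq hf hv.c1 hV hde] at hp
      simp only [Pi.zero_apply, zero_smul, Finset.sum_const_zero, add_zero] at hp
      exact (neg_add_eq_zero.1 hp.symm).symm
  · subst hps hp
    exact hr.isAdjointSolution hf hv.c1 hV hde hbc

end IsNormallyHyperbolic

theorem IsCotangent.adjointPairing_eq (hr : IsCotangent ρ V r) (hf : IsC1Field f) (hv : IsC1 v)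
    (hV : IsVariationalSolution f T p v V) (hde : ∀ φ, ∀ τ ∈ Icc (0 : ℝ) 1, ldE φ τ = r φ τ)
    (hbc : ∀ φ, lbc φ = r φ 1) (y : Violations n × Vec q) :
    adjointPairing ldE lbc 0 (∫ φ : Circ, (r φ 1).comp (PMat f T p v V φ 1)) y =
      ∫ φ, r φ 1 (returnRhs f T p v V y.1.1 y.1.2.1 y.2 φ) := by
  rw [hr.integral_apply_returnRhs_eq hf hv hV]
  simp [adjointPairing, hbc, fun φ (τ : unitInterval) => hde φ τ τ.2]

end Adjoint

section Cohomological

/-- The operator `a ↦ a(· + x) - a`, the left-hand side of the scalar cohomological equation over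
the translation by `x`. -/
noncomputable def coboundary (𝕜 : Type*) [RCLike 𝕜] {G : Type*} [AddGroup G] [TopologicalSpace G]
    [ContinuousAdd G] (x : G) : C(G, 𝕜) →ₗ[𝕜] C(G, 𝕜) :=
  (ContinuousMap.compRightAlgHom 𝕜 𝕜 ⟨(· + x), continuous_add_const x⟩).toLinearMap - LinearMap.id

theorem coboundary_apply {𝕜 : Type*} [RCLike 𝕜] {G : Type*} [AddGroup G] [TopologicalSpace G]
    [ContinuousAdd G] (x : G) (a : C(G, 𝕜)) (y : G) : coboundary 𝕜 x a y = a (y + x) - a y :=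
  rfl

theorem coboundary_fourier (k : ℤ) (x : Circ) :
    coboundary ℂ x (fourier k) = (fourier k x - 1) • fourier k := by
  ext y
  simp only [coboundary_apply, ContinuousMap.smul_apply, smul_eq_mul, fourier_apply, smul_add,
    AddCircle.toCircle_add, Circle.coe_mul]
  ring

theorem denseRange_coboundary_add_const_complex {ρ : ℝ} (hρ : Irrational ρ) :
    DenseRange fun z : C(Circ, ℂ) × ℂ =>
      coboundary ℂ (ρ : Circ) z.1 + ContinuousMap.const Circ z.2 := by
  let B : C(Circ, ℂ) × ℂ →ₗ[ℂ] C(Circ, ℂ) :=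
    (coboundary ℂ (ρ : Circ)).coprod (Algebra.linearMap ℂ C(Circ, ℂ))
  have hfourier : ∀ k : ℤ, fourier k ∈ LinearMap.range B := fun k => by
    by_cases hk : k = 0
    · exact ⟨(0, 1), ContinuousMap.ext fun φ => by simp [B, hk]⟩
    · have hdiv : fourier k (ρ : Circ) - 1 ≠ 0 := fun h => by
        have h_ne := small_divisor_ne_zero hρ (neg_ne_zero.2 hk)
        rw [← fourier_neg_coe, neg_neg] at h_ne
        exact h_ne (by linear_combination -h)
      refine ⟨((fourier k (ρ : Circ) - 1)⁻¹ • fourier k, 0), ?_⟩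
      rw [LinearMap.coprod_apply, map_zero, add_zero, map_smul, coboundary_fourier, smul_smul,
        inv_mul_cancel₀ hdiv, one_smul]
  have htop : (LinearMap.range B).topologicalClosure = ⊤ := by
    rw [eq_top_iff, ← span_fourier_closure_eq_top (T := (1 : ℝ))]
    exact Submodule.topologicalClosure_mono (Submodule.span_le.2 (range_subset_iff.2 hfourier))
  exact Submodule.dense_iff_topologicalClosure_eq_top.2 htop

theorem denseRange_coboundary_add_const {ρ : ℝ} (hρ : Irrational ρ) :
    DenseRange fun z : C(Circ, ℝ) × ℝ =>
      coboundary ℝ (ρ : Circ) z.1 + ContinuousMap.const Circ z.2 := by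
  let re : C(ℂ, ℝ) := ⟨Complex.re, Complex.continuous_re⟩
  have hre : Function.Surjective fun g : C(Circ, ℂ) => re.comp g := fun g =>
    ⟨(⟨Complex.ofReal, Complex.continuous_ofReal⟩ : C(ℝ, ℂ)).comp g, by ext; simp [re]⟩
  refine (hre.denseRange.comp (denseRange_coboundary_add_const_complex hρ)
    re.continuous_postcomp).mono ?_
  rintro _ ⟨z, rfl⟩
  exact ⟨(re.comp z.1, z.2.re), by ext; simp [re, coboundary_apply]⟩

end Cohomological

section DenseRange

variable {n q : ℕ} {f : Vec n → Vec q → Vec n} {T ρ : ℝ} {p : Vec q} {v : Circ → ℝ → Vec n}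
  {A V : Circ → ℝ → Vec n →L[ℝ] Vec n} {e : Circ → ℝ → Vec n} {qτ qφ : Circ → ℝ → Cov n}
  {K : Fin 2 → C(Strip, Cov n)} {H : Fin 2 → Cov q}

theorem IsFundamental.exists_stripFun (hV : IsFundamental A V) (u : C(Circ, Vec n))
    (g : C(Strip, Vec n)) : ∃ w : StripFun n, (∀ φ, w.1.1 (φ, 0) = u φ) ∧
      ∀ z : Strip, w.1.2 z = A z.1 z.2 (w.1.1 z) + g z := by
  let k : Strip → ℝ → Vec n := fun z σ => (V z.1 (projIcc (0 : ℝ) 1 zero_le_one σ)).inverse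
    (g (z.1, projIcc 0 1 zero_le_one σ))
  have hk : Continuous (Function.uncurry k) := by
    have hproj : Continuous fun y : Strip × ℝ => ((y.1.1, projIcc 0 1 zero_le_one y.2) : Strip) :=
      (continuous_fst.comp continuous_fst).prodMk (continuous_projIcc.comp continuous_snd)
    exact (hV.continuous_inverse.comp hproj).clm_apply ((map_continuous g).comp hproj)
  let y : C(Strip, Vec n) := ⟨fun z => V z.1 z.2 (u z.1 + ∫ σ in (0 : ℝ)..z.2, k z σ),
    hV.continuous.clm_apply (((map_continuous u).comp continuous_fst).add
      (intervalIntegral.continuous_parametric_intervalIntegral_of_continuous hk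
        (continuous_subtype_val.comp continuous_snd)))⟩
  let y' : C(Strip, Vec n) := ⟨fun z => A z.1 z.2 (y z) + g z,
    ((continuous_restrict_strip hV.cont).clm_apply (map_continuous y)).add (map_continuous g)⟩
  refine ⟨⟨(y, y'), fun φ τ => ?_⟩, fun φ => by simp [y, hV.init], fun z => rfl⟩
  have hkφ : Continuous (k (φ, 0)) := hk.uncurry_left (φ, (0 : unitInterval))
  have hder := (hV.ode φ τ).clm_apply
    ((intervalIntegral.integral_hasDerivAt_right (hkφ.intervalIntegrable 0 τ)
      (hkφ.stronglyMeasurableAtFilter _ _) hkφ.continuousAt).const_add (u φ))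
  refine (hder.hasDerivWithinAt (s := Icc (0 : ℝ) 1)).congr_of_mem (fun s hs => ?_) τ.2
    |>.congr_deriv ?_
  · simp only [y, ContinuousMap.coe_mk, projIcc_of_mem zero_le_one hs, k]
  · simp only [y', y, ContinuousMap.coe_mk, k, projIcc_val,
      (hV.isInvertible φ τ).self_apply_inverse, ContinuousLinearMap.comp_apply]

/-- The variations `a(φ) e(φ, τ)` along a tangent field `e`, as a linear operator in `a`. -/
noncomputable def IsTangent.stripFun (he : IsTangent ρ A e)
    (hA : Continuous fun z : Circ × ℝ => A z.1 z.2) : C(Circ, ℝ) →ₗ[ℝ] StripFun n where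
  toFun a := ⟨(⟨fun z => a z.1 • e z.1 z.2, ((map_continuous a).comp continuous_fst).smul
      (continuous_restrict_strip he.cont)⟩,
    ⟨fun z => a z.1 • A z.1 z.2 (e z.1 z.2), ((map_continuous a).comp continuous_fst).smul
      (continuous_restrict_strip
        (g := fun φ τ => A φ τ (e φ τ)) (hA.clm_apply he.cont))⟩), fun φ τ => by
    refine ((he.ode φ τ).const_smul (a φ)).hasDerivWithinAt.congr_of_mem (fun s hs => ?_) τ.2
    simp [projIcc_of_mem zero_le_one hs]⟩
  map_add' a b := by
    refine Subtype.ext (Prod.ext ?_ ?_) <;> ext1 z <;> simp [add_smul]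
  map_smul' c a := by
    refine Subtype.ext (Prod.ext ?_ ?_) <;> ext1 z <;> simp [mul_smul]

theorem linOde_stripFun (hf : IsC1Field f) (hv : IsC1 v) (he : IsTangent ρ (coeff f T p v) e)
    (a : C(Circ, ℝ)) : linOde hf T p hv (he.stripFun (continuous_coeff hf hv) a, 0) = 0 := by
  ext1 z
  simp [linOde, IsTangent.stripFun, coeff, smul_comm T]

theorem linBc_stripFun (hv : IsC1 v) (he : IsTangent ρ A e)
    (hA : Continuous fun z : Circ × ℝ => A z.1 z.2) (a : C(Circ, ℝ)) (φ : Circ) :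
    linBc (q := q) ρ hv (he.stripFun hA a, 0) φ =
      coboundary ℝ (ρ : Circ) a φ • e (φ + (ρ : Circ)) 0 := by
  have he_one : e φ 1 = e (φ + (ρ : Circ)) 0 := by rw [← he.shift, zero_add]
  simp [linBc, IsTangent.stripFun, coboundary_apply, he_one, sub_smul]

theorem exists_linReduced_eq_shift (hf : IsC1Field f) (hv : IsTorusSolution f T ρ p v)
    (hK : (phaseMatrix v K).det ≠ 0) (H : Fin 2 → Cov q) (δh : EuclideanSpace ℝ (Fin 2)) :
    ∃ x : Unknowns n q, linReduced hf T ρ p hv.c1 K H x = ((0, 0, δh), 0) := by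
  have he := hv.isTangent_tangentField hf ((phaseMatrix v K)⁻¹.mulVec δh)
  refine ⟨(he.stripFun (continuous_coeff hf hv.c1) 1, 0), Prod.ext (Prod.ext
    (linOde_stripFun hf hv.c1 he 1) (Prod.ext (ContinuousMap.ext fun φ => ?_) ?_)) rfl⟩
  · exact (linBc_stripFun hv.c1 he _ 1 φ).trans (by simp [coboundary_apply])
  · refine (linPs_eq_mulVec (c := (phaseMatrix v K)⁻¹.mulVec δh) hf hv K H
      (fun φ τ => one_smul ℝ (tangentField v _ φ τ)) rfl).trans ?_
    rw [Matrix.mulVec_mulVec, Matrix.mul_nonsing_inv _ (isUnit_iff_ne_zero.2 hK),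
      Matrix.one_mulVec, WithLp.toLp_ofLp]

/-- The boundary data `a ∂_τ v(·, 1) + b ∂_φ v(·, 1)` along the torus, for functions `(a, b)` on the
circle. -/
noncomputable def IsTorusSolution.tangentData (hv : IsTorusSolution f T ρ p v) (hf : IsC1Field f)
    (g : C(Circ, ℝ) × C(Circ, ℝ)) : C(Circ, Vec n) :=
  ⟨fun φ => g.1 φ • dtau v φ 1 + g.2 φ • dphi v φ 1,
    ((map_continuous g.1).smul
      ((hv.isTangent_dtau hf).cont.comp (Continuous.prodMk_left (1 : ℝ)))).add
    ((map_continuous g.2).smul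
      ((hv.isTangent_dphi hf).cont.comp (Continuous.prodMk_left (1 : ℝ))))⟩

theorem IsTorusSolution.continuous_tangentData (hv : IsTorusSolution f T ρ p v)
    (hf : IsC1Field f) : Continuous (hv.tangentData hf) := by
  have hslice : Continuous fun z : (C(Circ, ℝ) × C(Circ, ℝ)) × Circ => (z.2, (1 : ℝ)) :=
    continuous_snd.prodMk continuous_const
  have hfst : Continuous fun z : (C(Circ, ℝ) × C(Circ, ℝ)) × Circ => z.1.1 z.2 := by fun_prop
  have hsnd : Continuous fun z : (C(Circ, ℝ) × C(Circ, ℝ)) × Circ => z.1.2 z.2 := by fun_prop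
  exact ContinuousMap.continuous_of_continuous_uncurry _
    ((hfst.smul ((hv.isTangent_dtau hf).cont.comp hslice)).add
      (hsnd.smul ((hv.isTangent_dphi hf).cont.comp hslice)))

namespace IsNormallyHyperbolic

theorem exists_return_solution_transversal (hq : IsNormallyHyperbolic ρ v V qτ qφ)
    (hf : IsC1Field f) (hv : IsTorusSolution f T ρ p v) (hV : IsVariationalSolution f T p v V)
    {m : Circ → Vec n} (hm : Continuous m) : ∃ w : C(Circ, Vec n), ∀ φ,
      w (φ + (ρ : Circ)) = V φ 1 (w φ) + qtr v qτ qφ (φ + (ρ : Circ)) 0 (m φ) := by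
  let g : C(Circ, Vec n) := ⟨fun φ => -qtr v qτ qφ φ 0 (m (φ - (ρ : Circ))),
    (hq.continuous_qtr_apply hf hv (hm.comp (continuous_id.sub continuous_const))).neg⟩
  have hg : IsTransversal v qτ qφ 0 g := hq.isTransversal_iff.2 fun φ => by
    simp [g, hq.cotangent_qtr]
  obtain ⟨w, hw⟩ := hq.exists_map_sub_eq hV hg
  refine ⟨w, fun φ => ?_⟩
  have h := hw φ
  simp only [g, ContinuousMap.coe_mk, add_sub_cancel_right] at h
  rw [eq_add_of_sub_eq h]
  abel

theorem exists_return_solution (hq : IsNormallyHyperbolic ρ v V qτ qφ) (hf : IsC1Field f)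
    (hv : IsTorusSolution f T ρ p v) (hV : IsVariationalSolution f T p v V) {m : Circ → Vec n}
    (hm : Continuous m) {a b : C(Circ, ℝ)} {c d : ℝ}
    (ha : ∀ φ, qτ φ 1 (m φ) = coboundary ℝ (ρ : Circ) a φ + c)
    (hb : ∀ φ, qφ φ 1 (m φ) = coboundary ℝ (ρ : Circ) b φ + d) :
    ∃ u : C(Circ, Vec n), ∀ φ, u (φ + (ρ : Circ)) = V φ 1 (u φ) + m φ
      - c • dtau v (φ + (ρ : Circ)) 0 - d • dphi v (φ + (ρ : Circ)) 0 := by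
  have hV' := hV.isFundamental hf hv.c1
  have heτ := hv.isTangent_dtau hf
  have heφ := hv.isTangent_dphi hf
  obtain ⟨w, hw⟩ := hq.exists_return_solution_transversal hf hv hV hm
  refine ⟨⟨fun φ => a φ • dtau v φ 0 + b φ • dphi v φ 0 + w φ,
    (((map_continuous a).smul heτ.continuous_zero).add
      ((map_continuous b).smul heφ.continuous_zero)).add (map_continuous w)⟩, fun φ => ?_⟩
  simp only [ContinuousMap.coe_mk, map_add, map_smul, heτ.map_one hV', heφ.map_one hV', hw,
    qtr_apply, ← (hq.isAdjointField_qτ hf hv hV).apply_one,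
    ← (hq.isAdjointField_qφ hf hv hV).apply_one, ha, hb, coboundary_apply]
  module

theorem exists_violation_preimage (hq : IsNormallyHyperbolic ρ v V qτ qφ) (hf : IsC1Field f)
    (hv : IsTorusSolution f T ρ p v) (hV : IsVariationalSolution f T p v V)
    (δode : C(Strip, Vec n)) (δbc : C(Circ, Vec n)) (δp : Vec q) {a b : C(Circ, ℝ)} {c d : ℝ}
    (ha : ∀ φ, qτ φ 1 (returnRhs f T p v V δode δbc δp φ) = coboundary ℝ (ρ : Circ) a φ + c)
    (hb : ∀ φ, qφ φ 1 (returnRhs f T p v V δode δbc δp φ) = coboundary ℝ (ρ : Circ) b φ + d) :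
    ∃ x : Unknowns n q, linOde hf T p hv.c1 x = δode ∧ linBc ρ hv.c1 x = δbc ∧ x.2.2.2 = δp := by
  obtain ⟨u, hu⟩ := hq.exists_return_solution hf hv hV
    (continuous_returnRhs hf hv.c1 hV δode δbc δp) ha hb
  have hfv : Continuous fun z : Strip => f (v z.1 z.2) p :=
    continuous_restrict_strip (g := fun φ τ => f (v φ τ) p)
      ((hf.continuous p).comp hv.c1.continuous)
  let g : C(Strip, Vec n) := ⟨fun z =>
      (δode z + T • dp f (v z.1 z.2) p δp) + (-(c * T)) • f (v z.1 z.2) p,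
    ((map_continuous δode).add (((continuous_strip_dp hf hv.c1).clm_apply
      continuous_const).const_smul T)).add (hfv.const_smul (-(c * T)))⟩
  obtain ⟨δv, hδv_zero, hδv⟩ := (hV.isFundamental hf hv.c1).exists_stripFun u g
  set x : Unknowns n q := (δv, -(c * T), d, δp) with hx
  have hode : linOde hf T p hv.c1 x = δode := by
    ext1 z
    have h := snd_sub_coeff_apply (T := T) (p := p) hf hv.c1 x z
    rw [hx, hδv z, add_sub_cancel_left] at h
    exact (add_right_cancel (add_right_cancel h)).symm
  refine ⟨x, hode, ContinuousMap.ext fun φ => ?_, rfl⟩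
  have h := return_map hf hv hV x φ
  rw [hode, hx, hδv_zero, hδv_zero, hu, hv.dtau_eq] at h
  simp only [returnRhs, deltaRhs, smul_smul, neg_smul, ← sub_eq_add_neg, sub_left_inj,
    add_right_inj, add_left_inj] at h
  exact h.symm

theorem exists_linReduced_eq (hq : IsNormallyHyperbolic ρ v V qτ qφ) (hf : IsC1Field f)
    (hv : IsTorusSolution f T ρ p v) (hV : IsVariationalSolution f T p v V)
    (hK : (phaseMatrix v K).det ≠ 0) (H : Fin 2 → Cov q) (y : Violations n × Vec q)
    {a b : C(Circ, ℝ)} {c d : ℝ}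
    (ha : ∀ φ, qτ φ 1 (returnRhs f T p v V y.1.1 y.1.2.1 y.2 φ) =
      coboundary ℝ (ρ : Circ) a φ + c)
    (hb : ∀ φ, qφ φ 1 (returnRhs f T p v V y.1.1 y.1.2.1 y.2 φ) =
      coboundary ℝ (ρ : Circ) b φ + d) :
    ∃ x : Unknowns n q, linReduced hf T ρ p hv.c1 K H x = y := by
  obtain ⟨x, hode, hbc, hp⟩ := hq.exists_violation_preimage hf hv hV y.1.1 y.1.2.1 y.2 ha hb
  obtain ⟨s, hs⟩ := exists_linReduced_eq_shift hf hv hK H (y.1.2.2 - linPs K H x)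
  refine ⟨x + s, ?_⟩
  rw [map_add, hs]
  exact Prod.ext (Prod.ext ((add_zero _).trans hode) (Prod.ext ((add_zero _).trans hbc)
    (add_sub_cancel (linPs K H x) _))) ((add_zero _).trans hp)

theorem cotangent_returnRhs_add (hq : IsNormallyHyperbolic ρ v V qτ qφ) (δode : C(Strip, Vec n))
    (δbc κ : C(Circ, Vec n)) (δp : Vec q) {φ : Circ} {a b : ℝ}
    (hκ : κ φ = a • dtau v φ 1 + b • dphi v φ 1) :
    qτ φ 1 (returnRhs f T p v V δode (δbc + κ) δp φ) =
        qτ φ 1 (returnRhs f T p v V δode δbc δp φ) + a ∧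
      qφ φ 1 (returnRhs f T p v V δode (δbc + κ) δp φ) =
        qφ φ 1 (returnRhs f T p v V δode δbc δp φ) + b := by
  have hadd : returnRhs f T p v V δode (δbc + κ) δp φ =
      returnRhs f T p v V δode δbc δp φ + κ φ := by
    simp only [returnRhs, deltaRhs, ContinuousMap.add_apply]
    abel
  rw [hadd, map_add, map_add, hκ, hq.qτ_tangent, hq.qφ_tangent]
  exact ⟨rfl, rfl⟩

-- Perturbing `δ_bc` along the tangent fields changes the right-hand sides of the two scalar
-- cohomological equations arbitrarily, and the solvable right-hand sides are dense.
theorem denseRange_linReduced (hq : IsNormallyHyperbolic ρ v V qτ qφ) (hρ : Irrational ρ)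
    (hf : IsC1Field f) (hv : IsTorusSolution f T ρ p v) (hV : IsVariationalSolution f T p v V)
    (hK : (phaseMatrix v K).det ≠ 0) (H : Fin 2 → Cov q) :
    DenseRange (linReduced hf T ρ p hv.c1 K H) := by
  intro y
  have hm := continuous_returnRhs hf hv.c1 hV y.1.1 y.1.2.1 y.2
  let mτ : C(Circ, ℝ) := ⟨fun φ => qτ φ 1 (returnRhs f T p v V y.1.1 y.1.2.1 y.2 φ),
    (hq.isAdjointField_qτ hf hv hV).continuous_one.clm_apply hm⟩
  let mφ : C(Circ, ℝ) := ⟨fun φ => qφ φ 1 (returnRhs f T p v V y.1.1 y.1.2.1 y.2 φ),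
    (hq.isAdjointField_qφ hf hv hV).continuous_one.clm_apply hm⟩
  have hΦ : Continuous fun g =>
      (((y.1.1, y.1.2.1 + hv.tangentData hf g, y.1.2.2), y.2) : Violations n × Vec q) :=
    (continuous_const.prodMk ((continuous_const.add (hv.continuous_tangentData hf)).prodMk
      continuous_const)).prodMk continuous_const
  have hdense := (Homeomorph.subRight (mτ, mφ)).surjective.denseRange.comp
    ((denseRange_coboundary_add_const hρ).prodMap (denseRange_coboundary_add_const hρ))
    (Homeomorph.subRight (mτ, mφ)).continuous
  have h_zero : hv.tangentData hf 0 = 0 := by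
    ext1 φ
    simp [IsTorusSolution.tangentData]
  have hclosure := map_mem_closure hΦ (hdense 0) (t := range (linReduced hf T ρ p hv.c1 K H))
  simp only [h_zero, add_zero] at hclosure
  refine hclosure ?_
  rintro _ ⟨⟨⟨a, c⟩, b, d⟩, rfl⟩
  refine hq.exists_linReduced_eq hf hv hV hK H _ (a := a) (c := c) (b := b) (d := d)
    (fun φ => ?_) fun φ => ?_
  · exact (hq.cotangent_returnRhs_add y.1.1 y.1.2.1 _ y.2 rfl).1.trans
      (add_sub_cancel (mτ φ) (coboundary ℝ (ρ : Circ) a φ + c))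
  · exact (hq.cotangent_returnRhs_add y.1.1 y.1.2.1 _ y.2 rfl).2.trans
      (add_sub_cancel (mφ φ) (coboundary ℝ (ρ : Circ) b φ + d))

end IsNormallyHyperbolic

end DenseRange

section NearlyInvariant

open scoped ContDiff
open Polynomial (aeval degreeLT degreeLTEquiv)

theorem eventually_norm_apply_le {X E F : Type*} [TopologicalSpace X] [NormedAddCommGroup E]
    [NormedSpace ℝ E] [FiniteDimensional ℝ E] [NormedAddCommGroup F] [NormedSpace ℝ F]
    {D : X → E →ₗ[ℝ] F} (hD : ∀ g, Continuous fun t => D t g) {x : X} (hx : D x = 0) {ε : ℝ}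
    (hε : 0 < ε) : ∀ᶠ t in nhds x, ∀ g, ‖D t g‖ ≤ ε * ‖g‖ := by
  let D' : X → E →L[ℝ] F := fun t => LinearMap.toContinuousLinearMap (D t)
  have hD' : Continuous D' := continuous_clm_apply.2 hD
  have hlt : ∀ᶠ t in nhds x, ‖D' t‖ < ε :=
    hD'.norm.continuousAt.eventually_lt_const (by simpa [D', hx] using hε)
  filter_upwards [hlt] with t ht
  exact (D' t).le_of_opNorm_le ht.le

theorem eventually_norm_coboundary_le {G : Type*} [AddGroup G] [TopologicalSpace G]
    [ContinuousAdd G] [CompactSpace G] (W : Submodule ℝ C(G, ℝ)) [FiniteDimensional ℝ W] {ε : ℝ}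
    (hε : 0 < ε) : ∀ᶠ t : G in nhds 0, ∀ g : W, ‖coboundary ℝ t g.1‖ ≤ ε * ‖g.1‖ := by
  refine eventually_norm_apply_le (E := W) (D := fun t => coboundary ℝ t ∘ₗ W.subtype)
    (fun g => ?_) ?_ hε
  · exact ContinuousMap.continuous_of_continuous_uncurry _
      (((map_continuous g.1).comp (continuous_snd.add continuous_fst)).sub
        ((map_continuous g.1).comp continuous_snd))
  · ext g y
    simp [coboundary_apply]

theorem coboundary_comp_zsmul {G : Type*} [AddCommGroup G] [TopologicalSpace G]
    [IsTopologicalAddGroup G] (k : ℤ) (x : G) (g : C(G, ℝ)) :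
    coboundary ℝ x (g.comp ⟨(k • ·), continuous_zsmul k⟩) =
      (coboundary ℝ (k • x) g).comp ⟨(k • ·), continuous_zsmul k⟩ := by
  ext y
  simp [coboundary_apply, smul_add]

theorem norm_comp_of_surjective {X Y : Type*} [TopologicalSpace X] [CompactSpace X]
    [TopologicalSpace Y] [CompactSpace Y] (g : C(Y, ℝ)) {s : C(X, Y)}
    (hs : Function.Surjective s) : ‖g.comp s‖ = ‖g‖ := by
  rw [ContinuousMap.norm_eq_iSup_norm, ContinuousMap.norm_eq_iSup_norm]
  exact hs.iSup_comp fun y => ‖g y‖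

/-- The function `φ ↦ cos 2πφ` on the circle. -/
noncomputable def circCos : C(Circ, ℝ) :=
  ⟨fun φ => (fourier 1 φ : ℂ).re, Complex.continuous_re.comp (map_continuous (fourier 1))⟩

theorem circCos_coe (s : ℝ) : circCos (s : Circ) = Real.cos (2 * Real.pi * s) := by
  rw [← Complex.exp_ofReal_mul_I_re]
  simp only [circCos, ContinuousMap.coe_mk, fourier_coe_apply]
  congr 2
  push_cast
  ring

theorem aeval_circCos_injective :
    Function.Injective (aeval circCos : Polynomial ℝ →ₐ[ℝ] C(Circ, ℝ)) := by
  rw [injective_iff_map_eq_zero]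
  intro P hP
  have hzero : (circCos : Circ → ℝ) 0 = 1 := by simpa using circCos_coe 0
  have hhalf : circCos ((1 / 2 : ℝ) : Circ) = -1 := by
    rw [circCos_coe, mul_one_div, mul_div_cancel_left₀ _ two_ne_zero, Real.cos_pi]
  have hinf : (range circCos).Infinite :=
    (isPreconnected_range (map_continuous circCos)).infinite_of_nontrivial
      ⟨1, ⟨0, hzero⟩, -1, ⟨_, hhalf⟩, by norm_num⟩
  refine P.eq_zero_of_infinite_isRoot (hinf.mono ?_)
  rintro _ ⟨φ, rfl⟩
  exact (Polynomial.aeval_continuousMap_apply P circCos φ).symm.trans (DFunLike.congr_fun hP φ)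

theorem contDiff_aeval_circCos_zsmul (P : Polynomial ℝ) (k : ℤ) :
    ContDiff ℝ ω fun s : ℝ => aeval circCos P (k • (s : Circ)) := by
  have h : (fun s : ℝ => aeval circCos P (k • (s : Circ))) = fun s =>
      aeval (Real.cos (2 * Real.pi * (k • s))) P := by
    ext s
    rw [Polynomial.aeval_continuousMap_apply, ← QuotientAddGroup.mk_zsmul, ← circCos_coe,
      Polynomial.coe_aeval_eq_eval]
  rw [h]
  exact (Polynomial.contDiff_aeval P ω).comp
    (Real.contDiff_cos.comp (contDiff_const.mul (contDiff_id.const_smul k)))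

-- Functions `g(kφ)`, with `kρ` close to `0` and `g` in a fixed finite-dimensional space, are
-- nearly invariant under the rotation by `ρ`; the dimension of that space beats `ψ`.
theorem exists_norm_coboundary_le {Y : Type*} [AddCommGroup Y] [Module ℝ Y]
    [FiniteDimensional ℝ Y] (ρ : Circ) (ψ : C(Circ, ℝ) →ₗ[ℝ] Y) {ε : ℝ} (hε : 0 < ε) :
    ∃ a : C(Circ, ℝ), a ≠ 0 ∧ (ContDiff ℝ ω fun s : ℝ => a (s : Circ)) ∧ ψ a = 0 ∧
      ‖coboundary ℝ ρ a‖ ≤ ε * ‖a‖ := by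
  let m := Module.finrank ℝ Y + 1
  have : FiniteDimensional ℝ (degreeLT ℝ m) := (degreeLTEquiv ℝ m).symm.finiteDimensional
  let B : degreeLT ℝ m →ₗ[ℝ] C(Circ, ℝ) := (aeval circCos).toLinearMap ∘ₗ (degreeLT ℝ m).subtype
  obtain ⟨k, hk, hsmall⟩ := exists_pos_nsmul_mem_of_mem_nhds_zero ρ
    (eventually_norm_coboundary_le (LinearMap.range B) hε)
  rw [← natCast_zsmul] at hsmall
  let dilation : C(Circ, Circ) := ⟨((k : ℤ) • ·), continuous_zsmul (k : ℤ)⟩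
  have hdilation : Function.Surjective dilation :=
    DivisibleBy.surjective_smul Circ ℤ (Nat.cast_ne_zero.2 hk.ne')
  have hker : LinearMap.ker (ψ ∘ₗ (dilation.compRightAlgHom ℝ ℝ).toLinearMap ∘ₗ B) ≠ ⊥ :=
    LinearMap.ker_ne_bot_of_finrank_lt (by
      rw [(degreeLTEquiv ℝ m).finrank_eq, Module.finrank_fin_fun]
      exact Nat.lt_succ_self _)
  obtain ⟨P, hP, hP_ne⟩ := Submodule.exists_mem_ne_zero_of_ne_bot hker
  have hBP : B P ≠ 0 := fun h =>
    hP_ne (Subtype.ext (aeval_circCos_injective (h.trans (map_zero _).symm)))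
  refine ⟨(B P).comp dilation, ?_, contDiff_aeval_circCos_zsmul P.1 k, hP, ?_⟩
  · rwa [← norm_ne_zero_iff, norm_comp_of_surjective _ hdilation, norm_ne_zero_iff]
  · rw [coboundary_comp_zsmul, norm_comp_of_surjective _ hdilation,
      norm_comp_of_surjective _ hdilation]
    exact hsmall ⟨_, LinearMap.mem_range_self B P⟩

end NearlyInvariant

section Unbounded

theorem exists_norm_le_of_leftInverse {E F : Type*} [NormedAddCommGroup E] [NormedSpace ℝ E]
    [NormedAddCommGroup F] [NormedSpace ℝ F] (M : F →L[ℝ] E) {L : E → F}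
    (hM : ∀ x, M (L x) = x) : ∃ c, 0 < c ∧ ∀ x, ‖x‖ ≤ c * ‖L x‖ := by
  obtain ⟨c, hc, hMc⟩ := M.bound
  exact ⟨c, hc, fun x => (congr_arg norm (hM x)).symm.trans_le (hMc _)⟩

variable {n q : ℕ} {f : Vec n → Vec q → Vec n} {T ρ : ℝ} {p : Vec q} {v : Circ → ℝ → Vec n}
  {A V : Circ → ℝ → Vec n →L[ℝ] Vec n} {e : Circ → ℝ → Vec n} {qτ qφ : Circ → ℝ → Cov n}
  {K : Fin 2 → C(Strip, Cov n)} {H : Fin 2 → Cov q}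

theorem IsTangent.norm_linBc_stripFun_le (hv : IsC1 v) (he : IsTangent ρ A e)
    (hA : Continuous fun z : Circ × ℝ => A z.1 z.2) (a : C(Circ, ℝ)) {c : ℝ}
    (hc : ∀ φ, ‖e φ 0‖ ≤ c) : ‖linBc (q := q) ρ hv (he.stripFun hA a, 0)‖ ≤
      ‖coboundary ℝ (ρ : Circ) a‖ * c := by
  refine (ContinuousMap.norm_le_of_nonempty _).2 fun φ => ?_
  rw [linBc_stripFun, norm_smul]
  gcongr
  exacts [ContinuousMap.norm_coe_le_norm _ φ, hc _]

theorem IsTangent.norm_le_mul_norm_stripFun (he : IsTangent ρ A e)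
    (hA : Continuous fun z : Circ × ℝ => A z.1 z.2) (a : C(Circ, ℝ)) {r : Circ → Cov n} {c : ℝ}
    (hr : ∀ φ, r φ (e φ 0) = 1) (hc : ∀ φ, ‖r φ‖ ≤ c) :
    ‖a‖ ≤ c * ‖(he.stripFun hA a).1.1‖ := by
  refine (ContinuousMap.norm_le_of_nonempty _).2 fun φ => ?_
  have ha : a φ = r φ ((he.stripFun hA a).1.1 (φ, 0)) := by simp [IsTangent.stripFun, hr]
  rw [ha]
  exact (r φ).le_of_opNorm_le_of_le (hc φ) (ContinuousMap.norm_coe_le_norm _ _)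

theorem IsTorusSolution.isC1_smul_dtau (hv : IsTorusSolution f T ρ p v) (hf : IsC1Field f)
    {a : Circ → ℝ} (ha : ContDiff ℝ 1 fun s : ℝ => a (s : Circ)) :
    IsC1 fun φ τ => a φ • dtau v φ τ := by
  have hfv : ContDiff ℝ 1 fun z : ℝ × ℝ => f (v (z.1 : Circ) z.2) p :=
    ContDiff.comp (g := fun y : Vec n × Vec q => f y.1 y.2) hf
      (ContDiff.prodMk hv.c1 contDiff_const)
  simp only [hv.dtau_eq]
  exact (ha.comp contDiff_fst).smul (hfv.const_smul T)

namespace IsNormallyHyperbolic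

theorem exists_linZero_small (hq : IsNormallyHyperbolic ρ v V qτ qφ) (hf : IsC1Field f)
    (hv : IsTorusSolution f T ρ p v) (K : Fin 2 → C(Strip, Cov n)) (H : Fin 2 → Cov q)
    {Y : Type*} [AddCommGroup Y] [Module ℝ Y] [FiniteDimensional ℝ Y]
    (ψ : Unknowns n q →ₗ[ℝ] Y) {ε : ℝ} (hε : 0 < ε) : ∃ x : Unknowns n q,
      (∃ w : Circ → ℝ → Vec n, IsC1 w ∧ ∀ (φ : Circ) (τ : unitInterval),
        x.1.1.1 (φ, τ) = w φ τ) ∧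
      x.2 = 0 ∧ ψ x = 0 ∧ 0 < ‖x.1.1.1‖ ∧ ‖linZero hf T ρ p hv.c1 K H x‖ ≤ ε * ‖x.1.1.1‖ := by
  have he := hv.isTangent_dtau hf
  have hA := continuous_coeff (T := T) (p := p) hf hv.c1
  have hslice : Continuous fun φ : Circ => (φ, (0 : ℝ)) := Continuous.prodMk_left 0
  let E : C(Circ, Vec n) := ⟨fun φ => dtau v φ 0, he.continuous_zero⟩
  let Q : C(Circ, Cov n) := ⟨fun φ => qτ φ 0, hq.cont_qτ.comp hslice⟩
  let L := linZero hf T ρ p hv.c1 K H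
  let ι : C(Circ, ℝ) →ₗ[ℝ] Unknowns n q := LinearMap.inl ℝ _ _ ∘ₗ he.stripFun hA
  obtain ⟨a, ha_ne, ha_smooth, ha, ha_small⟩ := exists_norm_coboundary_le (ρ : Circ)
    ((((LinearMap.snd ℝ _ _ ∘ₗ LinearMap.snd ℝ _ _ ∘ₗ L).prod ψ) ∘ₗ ι))
    (ε := ε / (‖E‖ * ‖Q‖ + 1)) (by positivity)
  have hlower : ‖a‖ ≤ ‖Q‖ * ‖(ι a).1.1.1‖ := he.norm_le_mul_norm_stripFun hA a (r := Q)
    (fun φ => by simpa [Q] using hq.qτ_tangent φ 0 1 0) (ContinuousMap.norm_coe_le_norm Q)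
  have hbc : ‖linBc ρ hv.c1 (ι a)‖ ≤ ε * ‖(ι a).1.1.1‖ := by
    calc ‖linBc ρ hv.c1 (ι a)‖ ≤ ‖coboundary ℝ (ρ : Circ) a‖ * ‖E‖ :=
          he.norm_linBc_stripFun_le hv.c1 hA a (ContinuousMap.norm_coe_le_norm E)
      _ ≤ ε / (‖E‖ * ‖Q‖ + 1) * (‖Q‖ * ‖(ι a).1.1.1‖) * ‖E‖ := by
          gcongr
          exact ha_small.trans (by gcongr)
      _ = ε * ‖(ι a).1.1.1‖ * (‖E‖ * ‖Q‖ / (‖E‖ * ‖Q‖ + 1)) := by ring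
      _ ≤ ε * ‖(ι a).1.1.1‖ := mul_le_of_le_one_right (by positivity)
          (div_le_one_of_le₀ (le_add_of_nonneg_right zero_le_one) (by positivity))
  have hpos : 0 < ‖(ι a).1.1.1‖ :=
    pos_of_mul_pos_right ((norm_pos_iff.2 ha_ne).trans_le hlower) (norm_nonneg Q)
  refine ⟨ι a, ⟨_, hv.isC1_smul_dtau hf (ha_smooth.of_le le_top), fun φ τ => rfl⟩, rfl,
    congr_arg Prod.snd ha, hpos, ?_⟩
  refine norm_prod_le_iff.2 ⟨?_, norm_prod_le_iff.2 ⟨hbc, ?_⟩⟩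
  · exact (norm_eq_zero.2 (linOde_stripFun hf hv.c1 he a)).trans_le (by positivity)
  · exact (norm_eq_zero.2 (congr_arg Prod.fst ha)).trans_le (by positivity)

theorem exists_large_of_norm_linReduced_le_one (hq : IsNormallyHyperbolic ρ v V qτ qφ)
    (hf : IsC1Field f) (hv : IsTorusSolution f T ρ p v) (K : Fin 2 → C(Strip, Cov n))
    (H : Fin 2 → Cov q) (C : ℝ) : ∃ x : Unknowns n q,
      (∃ w : Circ → ℝ → Vec n, IsC1 w ∧ ∀ (φ : Circ) (τ : unitInterval),
        x.1.1.1 (φ, τ) = w φ τ) ∧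
      ‖linReduced hf T ρ p hv.c1 K H x‖ ≤ 1 ∧ C < ‖x.1.1.1‖ := by
  obtain ⟨x, ⟨w, hw, hxw⟩, hx, -, hpos, hsmall⟩ := hq.exists_linZero_small hf hv K H
    (0 : Unknowns n q →ₗ[ℝ] ℝ) (ε := (|C| + 1)⁻¹) (by positivity)
  have hreduced : ‖linReduced hf T ρ p hv.c1 K H x‖ ≤ (|C| + 1)⁻¹ * ‖x.1.1.1‖ :=
    norm_prod_le_iff.2 ⟨hsmall, by
      change ‖x.2.2.2‖ ≤ _
      rw [hx]
      simpa using by positivity⟩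
  set c : ℝ := (|C| + 1) / ‖x.1.1.1‖ with hc
  have hc_pos : 0 < c := by positivity
  refine ⟨c • x, ⟨fun φ τ => c • w φ τ, ContDiff.const_smul c hw, fun φ τ => ?_⟩, ?_, ?_⟩
  · exact congr_arg (c • ·) (hxw φ τ)
  · rw [map_smul, norm_smul, Real.norm_of_nonneg hc_pos.le]
    calc c * ‖linReduced hf T ρ p hv.c1 K H x‖ ≤ c * ((|C| + 1)⁻¹ * ‖x.1.1.1‖) := by gcongr
      _ = 1 := by rw [hc]; field_simp
  · change C < ‖c • x.1.1.1‖
    rw [norm_smul, Real.norm_of_nonneg hc_pos.le, hc, div_mul_cancel₀ _ hpos.ne']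
    exact (le_abs_self C).trans_lt (lt_add_one _)

theorem not_exists_leftInverse (hq : IsNormallyHyperbolic ρ v V qτ qφ)
    (hf : IsC1Field f) (hv : IsTorusSolution f T ρ p v) (K : Fin 2 → C(Strip, Cov n))
    (H : Fin 2 → Cov q) {Y : Type*} [NormedAddCommGroup Y] [NormedSpace ℝ Y]
    [FiniteDimensional ℝ Y] (ψ : Unknowns n q →ₗ[ℝ] Y) :
    ¬∃ M : Violations n × Y →L[ℝ] Unknowns n q,
      ∀ x, M (linZero hf T ρ p hv.c1 K H x, ψ x) = x := by
  rintro ⟨M, hM⟩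
  obtain ⟨c, hc, hle⟩ :=
    exists_norm_le_of_leftInverse (E := Unknowns n q) (F := Violations n × Y) M hM
  obtain ⟨x, -, -, hψ, hpos, hsmall⟩ := hq.exists_linZero_small hf hv K H ψ
    (ε := (c + 1)⁻¹) (by positivity)
  have hle_mul : ‖x.1.1.1‖ ≤ c * ((c + 1)⁻¹ * ‖x.1.1.1‖) :=
    calc ‖x.1.1.1‖ ≤ ‖x‖ := (norm_fst_le x.1.1).trans (norm_fst_le x)
      _ ≤ c * ‖(linZero hf T ρ p hv.c1 K H x, ψ x)‖ := hle x
      _ ≤ c * ((c + 1)⁻¹ * ‖x.1.1.1‖) := by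
          gcongr
          exact norm_prod_le_iff.2 ⟨hsmall, by
            rw [hψ, norm_zero]
            positivity⟩
  have hlt : c * ((c + 1)⁻¹ * ‖x.1.1.1‖) < ‖x.1.1.1‖ := by
    rw [← mul_assoc, ← div_eq_mul_inv]
    exact mul_lt_of_lt_one_left hpos ((div_lt_one (by positivity)).2 (lt_add_one _))
  exact hlt.not_ge hle_mul

end IsNormallyHyperbolic

end Unbounded

section Sensitivity

variable {n q : ℕ} {f : Vec n → Vec q → Vec n} {T ρ : ℝ} {p : Vec q} {v : Circ → ℝ → Vec n}
  {V : Circ → ℝ → Vec n →L[ℝ] Vec n} {qτ qφ r : Circ → ℝ → Cov n}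
  {K : Fin 2 → C(Strip, Cov n)} {H : Fin 2 → Cov q} {etaT etaρ : ℝ}

namespace IsNormallyHyperbolic

theorem isAdjointField_smul_qτ (hq : IsNormallyHyperbolic ρ v V qτ qφ) (hf : IsC1Field f)
    (hv : IsTorusSolution f T ρ p v) (hV : IsVariationalSolution f T p v V) :
    IsAdjointField f ρ p v V (fun φ τ => T • qτ φ τ) 1 0 := by
  simpa [hq.T_ne_zero hv] using (hq.isAdjointField_qτ hf hv hV).const_smul T

theorem isAdjointField_neg_qφ (hq : IsNormallyHyperbolic ρ v V qτ qφ) (hf : IsC1Field f)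
    (hv : IsTorusSolution f T ρ p v) (hV : IsVariationalSolution f T p v V) :
    IsAdjointField f ρ p v V (fun φ τ => -qφ φ τ) 0 1 := by
  simpa only [neg_one_smul ℝ (qφ _ _), mul_zero, mul_neg, mul_one, neg_neg] using
    (hq.isAdjointField_qφ hf hv hV).const_smul (-1)

theorem exists_sensitivity_row (hq : IsNormallyHyperbolic ρ v V qτ qφ) (hρ : Irrational ρ)
    (hf : IsC1Field f) (hv : IsTorusSolution f T ρ p v) (hV : IsVariationalSolution f T p v V)
    (hK : (phaseMatrix v K).det ≠ 0) (hr : IsAdjointField f ρ p v V r etaT etaρ) :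
    ∃ R : Violations n × Vec q →L[ℝ] ℝ,
      (∀ x, R (linReduced hf T ρ p hv.c1 K H x) = etaT * x.2.1 + etaρ * x.2.2.1) ∧
      (∀ ldE lbc lps etap, IsAdjointSolution f T ρ p v K H ldE lbc lps etaT etaρ etap →
        ∀ y, R y = -adjointPairing ldE lbc lps etap y) ∧
      (∀ δp, R (0, δp) = -((∫ φ : Circ, (r φ 1).comp (PMat f T p v V φ 1)) δp)) ∧
      ∀ δh, R ((0, 0, δh), 0) = 0 := by
  obtain ⟨R, hR⟩ := hr.exists_row hf hv.c1 hV
  refine ⟨R, fun x => ?_, fun ldE lbc lps etap h y => ?_, fun δp => ?_, fun δh => ?_⟩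
  · exact (hR _).trans (neg_eq_iff_eq_neg.2 (hr.integral_returnRhs hf hv hV x))
  · obtain ⟨hde, hbc, rfl, rfl⟩ := (hq.isAdjointSolution_iff hρ hf hv hV hK hr).1 h
    rw [hR, hr.adjointPairing_eq hf hv.c1 hV hde hbc]
  · simp [hR, hr.integral_apply_returnRhs_eq hf hv.c1 hV]
  · simp [hR, hr.integral_apply_returnRhs_eq hf hv.c1 hV]

end IsNormallyHyperbolic

end Sensitivity

end QPTorus

open QPTorus in
theorem mainTheorem3 {n q : ℕ} (f : Vec n → Vec q → Vec n) (hf : IsC1Field f)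
    (T ρ : ℝ) (hρ : Irrational ρ) (p : Vec q)
    (v : Circ → ℝ → Vec n) (hv : IsTorusSolution f T ρ p v)
    (V : Circ → ℝ → Vec n →L[ℝ] Vec n) (hV : IsVariationalSolution f T p v V)
    (qτ qφ : Circ → ℝ → Cov n) (hq : IsNormallyHyperbolic ρ v V qτ qφ)
    (h : (Strip → Vec n) → Vec q → Fin 2 → ℝ)
    (K : Fin 2 → C(Strip, Cov n)) (H : Fin 2 → Cov q) (hh : IsPhaseCondition h p v K H) :
    -- small divisors: nonzero, but arbitrarily small
    ((∀ k : ℤ, k ≠ 0 → (1 : ℂ) - Complex.exp (-(2 * Real.pi * Complex.I * k * ρ)) ≠ 0) ∧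
      ∀ ε : ℝ, 0 < ε → ∃ k : ℤ, k ≠ 0 ∧
        ‖(1 : ℂ) - Complex.exp (-(2 * Real.pi * Complex.I * k * ρ))‖ < ε) ∧
    -- they are the divisors in the equations for the Fourier coefficients of the tangential
    -- components of `δ_v(·, 0)`
    (∀ (x : Unknowns n q) (k : ℤ), k ≠ 0 → ∀ r ∈ ({qτ, qφ} : Set (Circ → ℝ → Cov n)),
      ((1 : ℂ) - Complex.exp (-(2 * Real.pi * Complex.I * k * ρ))) *
          fourierCoeff (fun φ : Circ => ((r φ 0 (x.1.1.1 (φ, 0)) : ℝ) : ℂ)) k =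
        fourierCoeff (fun φ : Circ => ((r φ 0
          (deltaRhs V (linOde hf T p hv.c1 x) (linBc ρ hv.c1 x) (φ - (ρ : Circ))
            + PMat f T p v V (φ - (ρ : Circ)) 1 x.2.2.2) : ℝ) : ℂ)) k) ∧
    -- the linearization has a densely defined inverse
    Function.Injective (linReduced hf T ρ p hv.c1 K H) ∧
    DenseRange (linReduced hf T ρ p hv.c1 K H) ∧
    -- this inverse is unbounded, even as a map into the continuous functions with sup-norm and
    -- along continuously differentiable `δ_v`
    (∀ C : ℝ, ∃ x : Unknowns n q,
      (∃ w : Circ → ℝ → Vec n, IsC1 w ∧ ∀ (φ : Circ) (τ : unitInterval),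
        x.1.1.1 (φ, τ) = w φ τ) ∧
      ‖linReduced hf T ρ p hv.c1 K H x‖ ≤ 1 ∧ C < ‖x.1.1.1‖) ∧
    (¬ ∃ M : Violations n × Vec q →L[ℝ] Unknowns n q,
      (∀ x, M (linReduced hf T ρ p hv.c1 K H x) = x) ∧
      ∀ y, linReduced hf T ρ p hv.c1 K H (M y) = y) ∧
    -- the zero problem is not regular, whatever finitely many scalar conditions are appended
    (∀ (d : ℕ) (ψ : Unknowns n q →L[ℝ] EuclideanSpace ℝ (Fin d)),
      ¬ ∃ M : Violations n × EuclideanSpace ℝ (Fin d) →L[ℝ] Unknowns n q,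
        (∀ x, M (linZero hf T ρ p hv.c1 K H x, ψ x) = x) ∧
        ∀ y, (linZero hf T ρ p hv.c1 K H (M y), ψ (M y)) = y) ∧
    -- the mean equations for `δ_T` and `δ_ρ`
    (∀ x : Unknowns n q,
      (∫ φ : Circ, qτ (φ - (ρ : Circ)) 1
          (deltaRhs V (linOde hf T p hv.c1 x) (linBc ρ hv.c1 x) (φ - (ρ : Circ))))
        + (∫ φ : Circ, (qτ (φ - (ρ : Circ)) 1).comp (PMat f T p v V (φ - (ρ : Circ)) 1)) x.2.2.2
        = -(x.2.1 / T) ∧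
      (∫ φ : Circ, qφ (φ - (ρ : Circ)) 1
          (deltaRhs V (linOde hf T p hv.c1 x) (linBc ρ hv.c1 x) (φ - (ρ : Circ))))
        + (∫ φ : Circ, (qφ (φ - (ρ : Circ)) 1).comp (PMat f T p v V (φ - (ρ : Circ)) 1)) x.2.2.2
        = x.2.2.1) ∧
    -- existence and uniqueness of the adjoint variables
    (∀ (ldE : Circ → ℝ → Cov n) (lbc : C(Circ, Cov n)) (lps : Fin 2 → ℝ) (etap : Cov q),
      (IsAdjointSolution f T ρ p v K H ldE lbc lps 1 0 etap ↔
        (∀ φ, ∀ τ ∈ Set.Icc (0 : ℝ) 1, ldE φ τ = T • qτ φ τ) ∧ (∀ φ, lbc φ = T • qτ φ 1) ∧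
        lps = 0 ∧ etap = T • ∫ φ : Circ, (qτ φ 1).comp (PMat f T p v V φ 1)) ∧
      (IsAdjointSolution f T ρ p v K H ldE lbc lps 0 1 etap ↔
        (∀ φ, ∀ τ ∈ Set.Icc (0 : ℝ) 1, ldE φ τ = -qφ φ τ) ∧ (∀ φ, lbc φ = -qφ φ 1) ∧
        lps = 0 ∧ etap = -∫ φ : Circ, (qφ φ 1).comp (PMat f T p v V φ 1))) ∧
    -- the rows of the inverse giving `δ_T` and `δ_ρ` are bounded and are given by the adjoint
    -- variables; the sensitivity to the phase conditions vanishes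
    (∃ RT Rρ : Violations n × Vec q →L[ℝ] ℝ,
      (∀ x, RT (linReduced hf T ρ p hv.c1 K H x) = x.2.1) ∧
      (∀ x, Rρ (linReduced hf T ρ p hv.c1 K H x) = x.2.2.1) ∧
      (∀ (ldE : Circ → ℝ → Cov n) (lbc : C(Circ, Cov n)) (lps : Fin 2 → ℝ) (etap : Cov q),
        IsAdjointSolution f T ρ p v K H ldE lbc lps 1 0 etap →
          ∀ y, RT y = -adjointPairing ldE lbc lps etap y) ∧
      (∀ (ldE : Circ → ℝ → Cov n) (lbc : C(Circ, Cov n)) (lps : Fin 2 → ℝ) (etap : Cov q),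
        IsAdjointSolution f T ρ p v K H ldE lbc lps 0 1 etap →
          ∀ y, Rρ y = -adjointPairing ldE lbc lps etap y) ∧
      (∀ δp : Vec q,
        RT (0, δp) = -((T • ∫ φ : Circ, (qτ φ 1).comp (PMat f T p v V φ 1)) δp) ∧
        Rρ (0, δp) = -((-∫ φ : Circ, (qφ φ 1).comp (PMat f T p v V φ 1)) δp)) ∧
      (∀ δh : EuclideanSpace ℝ (Fin 2),
        RT ((0, 0, δh), 0) = 0 ∧ Rρ ((0, 0, δh), 0) = 0)) := by
  have hτ := hq.isAdjointField_qτ hf hv hV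
  have hφ := hq.isAdjointField_qφ hf hv hV
  have hT := hq.isAdjointField_smul_qτ hf hv hV
  have hneg := hq.isAdjointField_neg_qφ hf hv hV
  obtain ⟨RT, hRT, hRT_adj, hRT_p, hRT_h⟩ :=
    hq.exists_sensitivity_row (H := H) hρ hf hv hV hh.nondegenerate hT
  obtain ⟨Rρ, hRρ, hRρ_adj, hRρ_p, hRρ_h⟩ :=
    hq.exists_sensitivity_row (H := H) hρ hf hv hV hh.nondegenerate hneg
  rw [← integral_smul, ← integral_neg]
  refine ⟨⟨fun k hk => small_divisor_ne_zero hρ hk, fun ε hε => exists_small_divisor ρ hε⟩,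
    ?_, hq.linReduced_injective hρ hf hv hV hh.nondegenerate H,
    hq.denseRange_linReduced hρ hf hv hV hh.nondegenerate H,
    hq.exists_large_of_norm_linReduced_le_one hf hv K H,
    fun ⟨M, hM, _⟩ => hq.not_exists_leftInverse hf hv K H
      (LinearMap.snd ℝ ℝ (Vec q) ∘ₗ LinearMap.snd ℝ ℝ _ ∘ₗ LinearMap.snd ℝ (StripFun n) _) ⟨M, hM⟩,
    fun d ψ ⟨M, hM, _⟩ => hq.not_exists_leftInverse hf hv K H ψ.toLinearMap ⟨M, hM⟩,
    fun x => ⟨?_, ?_⟩,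
    fun ldE lbc lps etap => ⟨hq.isAdjointSolution_iff hρ hf hv hV hh.nondegenerate hT,
      hq.isAdjointSolution_iff hρ hf hv hV hh.nondegenerate hneg⟩,
    RT, Rρ, by simpa using hRT, by simpa using hRρ, hRT_adj, hRρ_adj,
    fun δp => ⟨hRT_p δp, hRρ_p δp⟩, fun δh => ⟨hRT_h δh, hRρ_h δh⟩⟩
  · rintro x k hk r (rfl | rfl)
    exacts [hτ.fourierCoeff_eq hf hv hV x hk, hφ.fourierCoeff_eq hf hv hV x hk]
  · simpa [inv_mul_eq_div] using hτ.mean_equation hf hv hV x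
  · simpa using hφ.mean_equation hf hv hV x
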